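/- Let $\alpha,\beta\ge -1/2$. For $n\ge 0$ let $P_n^{\alpha,\beta}$ be the Jacobi polynomial, i.e. the polynomial determined by the Rodrigues formula $$P_n^{\alpha,\beta}(x)=\frac{(-1)^n}{2^n n!}(1-x)^{-\alpha}(1+x)^{-\beta}\frac{d^n}{dx^n}\Big[(1-x)^{\alpha+n}(1+x)^{\beta+n}\Big],\qquad -1<x<1,$$ let $$h_n^{\alpha,\beta}=\int_{-1}^1 \big(P_n^{\alpha,\beta}(x)\big)^2(1-x)^\alpha(1+x)^\beta\,dx,\qquad \mathcal P_n^{\alpha,\beta}(\theta)=2^{(\alpha+\beta+1)/2}\big(h_n^{\alpha,\beta}\big)^{-1/2}P_n^{\alpha,\beta}(\cos\theta),$$ and define the Poisson–Jacobi kernel, for $t>0$ and $\theta,\varphi\in[0,\pi]$, by $$\mathcal H_t^{\alpha,\beta}(\theta,\varphi)=\sum_{n=0}^\infty e^{-t\left|n+\frac{\alpha+\beta+1}{2}\right|}\,\mathcal P_n^{\alpha,\beta}(\theta)\,\mathcal P_n^{\alpha,\beta}(\varphi).$$ **Theorem.** This series converges absolutely for all $t>0$ and $\theta,\varphi\in[0,\pi]$.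 Moreover, given any $T>0$, there is a constant $C>0$ depending only on $\alpha,\beta,T$ such that the following two estimates hold, where $X\simeq Y$ means that $X\le CY$ and $Y\le CX$. For all $\theta,\varphi\in[0,\pi]$ and $0<t\le T$, $$\mathcal H_t^{\alpha,\beta}(\theta,\varphi)\simeq \big(t^2+\theta^2+\varphi^2\big)^{-\alpha-1/2}\big(t^2+(\pi-\theta)^2+(\pi-\varphi)^2\big)^{-\beta-1/2}\,\frac{t}{t^2+(\theta-\varphi)^2},$$ and for all $\theta,\varphi\in[0,\pi]$ and $t\ge T$, $$\mathcal H_t^{\alpha,\beta}(\theta,\varphi)\simeq \exp\Big(-t\,\frac{\alpha+\beta+1}{2}\Big).$$ -/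

import Mathlib

noncomputable section

namespace JacobiPoisson

/-- The Jacobi polynomial `P_n^{α,β}`, as a real polynomial (so that its values at `x = ±1`
are defined). It is the expansion of the Rodrigues formula by the Leibniz rule; see
`eval_jacobiPoly_eq_rodrigues`, which shows that it is the polynomial given by that formula. -/
def jacobiPoly (α β : ℝ) (n : ℕ) : Polynomial ℝ :=
  ∑ k ∈ Finset.range (n + 1),
    Polynomial.C
        (((descPochhammer ℝ (n - k)).eval (α + n) / ((n - k).factorial : ℝ)) *
          ((descPochhammer ℝ k).eval (β + n) / (k.factorial : ℝ))) *
      (Polynomial.C (1 / 2) * (Polynomial.X - 1)) ^ k *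
      (Polynomial.C (1 / 2) * (Polynomial.X + 1)) ^ (n - k)

/-- The Rodrigues formula: for `-1 < x < 1`,
`P_n^{α,β}(x) = (-1)^n / (2^n n!) (1-x)^{-α} (1+x)^{-β} (d/dx)^n [(1-x)^{α+n} (1+x)^{β+n}]`. -/
theorem eval_jacobiPoly_eq_rodrigues (α β : ℝ) (n : ℕ) (x : ℝ) (hx : x ∈ Set.Ioo (-1 : ℝ) 1) :
    (jacobiPoly α β n).eval x =
      (-1) ^ n / (2 ^ n * (n.factorial : ℝ)) * (1 - x) ^ (-α) * (1 + x) ^ (-β) *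
        iteratedDeriv n (fun y : ℝ => (1 - y) ^ (α + n) * (1 + y) ^ (β + n)) x := by
  have h1 : 0 < 1 - x := by linarith [hx.2]
  have h2 : 0 < 1 + x := by linarith [hx.1]
  have hd : ∀ (r y : ℝ) (k : ℕ), iteratedDeriv k (fun z : ℝ => z ^ r) y =
      (descPochhammer ℝ k).eval r * y ^ (r - k) := by
    intro r y k
    rw [iteratedDeriv_eq_iterate, Real.iter_deriv_rpow_const]
  have hc1 : ContDiffAt ℝ n (fun y : ℝ => (1 - y) ^ (α + n)) x :=
    (contDiffAt_const.sub contDiffAt_id).rpow_const_of_ne h1.ne'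
  have hc2 : ContDiffAt ℝ n (fun y : ℝ => (1 + y) ^ (β + n)) x :=
    (contDiffAt_const.add contDiffAt_id).rpow_const_of_ne h2.ne'
  have e1 : ∀ k, iteratedDeriv k (fun y : ℝ => (1 - y) ^ (α + n)) x =
      (-1) ^ k * ((descPochhammer ℝ k).eval (α + n) * (1 - x) ^ (α + n - k)) := by
    intro k
    have := congrFun (iteratedDeriv_comp_const_sub k (fun z : ℝ => z ^ (α + (n : ℝ))) 1) x
    rw [this, hd, smul_eq_mul]
  have e2 : ∀ k, iteratedDeriv k (fun y : ℝ => (1 + y) ^ (β + n)) x =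
      (descPochhammer ℝ k).eval (β + n) * (1 + x) ^ (β + n - k) := by
    intro k
    have := congrFun (iteratedDeriv_comp_const_add k (fun z : ℝ => z ^ (β + (n : ℝ))) 1) x
    rw [this, hd]
  rw [iteratedDeriv_fun_mul hc1 hc2, jacobiPoly, Polynomial.eval_finsetSum,
    ← Finset.sum_range_reflect, Finset.mul_sum]
  refine Finset.sum_congr rfl fun i hi => ?_
  have hi' : i ≤ n := by simpa [Nat.lt_succ_iff] using hi
  have hni : n + 1 - 1 - i = n - i := by omega
  have hnn : n - (n - i) = i := by omega
  obtain ⟨j, rfl⟩ := Nat.exists_eq_add_of_le hi'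
  have hj : i + j - i = j := by omega
  rw [hni, hnn, hj, e1, e2]
  have p1 : (1 - x) ^ (α + ((i + j : ℕ) : ℝ) - i) = (1 - x) ^ α * (1 - x) ^ j := by
    rw [← Real.rpow_natCast (1 - x) j, ← Real.rpow_add h1]; congr 1; push_cast; ring
  have p2 : (1 + x) ^ (β + ((i + j : ℕ) : ℝ) - j) = (1 + x) ^ β * (1 + x) ^ i := by
    rw [← Real.rpow_natCast (1 + x) i, ← Real.rpow_add h2]; congr 1; push_cast; ring
  rw [p1, p2, Nat.cast_add_choose ℝ, Real.rpow_neg h1.le, Real.rpow_neg h2.le]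
  have a1 := (Real.rpow_pos_of_pos h1 α).ne'
  have a2 := (Real.rpow_pos_of_pos h2 β).ne'
  have f1 : ((i + j).factorial : ℝ) ≠ 0 := by exact_mod_cast (i + j).factorial_ne_zero
  have f2 : (i.factorial : ℝ) ≠ 0 := by exact_mod_cast i.factorial_ne_zero
  have f3 : (j.factorial : ℝ) ≠ 0 := by exact_mod_cast j.factorial_ne_zero
  simp only [Polynomial.eval_mul, Polynomial.eval_pow, Polynomial.eval_C, Polynomial.eval_sub,
    Polynomial.eval_add, Polynomial.eval_X, Polynomial.eval_one]
  have s1 : ((1 : ℝ) / 2 * (x - 1)) ^ j = (-1) ^ j * (1 - x) ^ j / 2 ^ j := by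
    rw [← mul_pow, ← div_pow]; congr 1; ring
  have s2 : ((1 : ℝ) / 2 * (x + 1)) ^ i = (1 + x) ^ i / 2 ^ i := by
    rw [← div_pow]; congr 1; ring
  have s3 : ((-1 : ℝ)) ^ (i + j) * (-1) ^ i = (-1) ^ j := by
    rw [pow_add, mul_right_comm, ← mul_pow]; simp
  rw [s1, s2, ← s3]
  field_simp
  ring

/-- `h_n^{α,β} = ‖P_n^{α,β}‖²` in `L²` of the measure `(1-x)^α (1+x)^β dx` on `[-1,1]`. -/
def jacobiNormSq (α β : ℝ) (n : ℕ) : ℝ :=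
  ∫ x in Set.Icc (-1 : ℝ) 1, ((jacobiPoly α β n).eval x) ^ 2 * ((1 - x) ^ α * (1 + x) ^ β)

/-- The normalized trigonometric Jacobi polynomial
`𝓟_n^{α,β}(θ) = 2^{(α+β+1)/2} (h_n^{α,β})^{-1/2} P_n^{α,β}(cos θ)`. -/
def trigJacobi (α β : ℝ) (n : ℕ) (θ : ℝ) : ℝ :=
  2 ^ ((α + β + 1) / 2) * (jacobiNormSq α β n) ^ (-(1 / 2) : ℝ) *
    (jacobiPoly α β n).eval (Real.cos θ)

/-- The Poisson–Jacobi kernel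
`𝓗_t^{α,β}(θ,φ) = ∑_{n ≥ 0} exp(-t |n + (α+β+1)/2|) 𝓟_n^{α,β}(θ) 𝓟_n^{α,β}(φ)`. -/
def poissonKernel (α β t θ φ : ℝ) : ℝ :=
  ∑' n : ℕ, Real.exp (-t * |(n : ℝ) + (α + β + 1) / 2|) *
    trigJacobi α β n θ * trigJacobi α β n φ

end JacobiPoisson

end

/-! Put r = e^(-t), s = sin²(θ/2), σ = sin²(φ/2), and let q_n be the Jacobi polynomial in the
variable s. Since α + β + 1 ≥ 0, the absolute value in the exponent is harmless and the kernel
equals e^(-t(α+β+1)/2) ∑ r^n q_n(s) q_n(σ) / ‖q_n‖². Its terms change sign, so termwise estimates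
cannot give the lower bound. The way out is Bailey's formula, which resums it into a double power
series with nonnegative terms (`poissonKernel_eq`, `baileySum`), in ξ = sin(θ/2) sin(φ/2) /
cosh(t/2) and η = cos(θ/2) cos(φ/2) / cosh(t/2). Here ξ + η = cos((θ-φ)/2) / cosh(t/2) < 1.

Bailey's formula rests on Watson's expression of q_n(s) q_n(σ) as a finite double sum in sσ and
(1-s)(1-σ) (`shiftedJacobi_mul`). Both sides are eigenfunctions of the Jacobi operator for the same
eigenvalue, and an eigenpolynomial is determined by its value at 0. With the explicit norms
(`shiftedNormSq_eq`), summing over n first gives the formula for small r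
(`tsum_jacobiProd_of_small`). Polynomial growth of the normalized products makes both sides analytic
on (0,1), and the identity theorem does the rest (`beta_mul_tsum_jacobiProd`).

The nonnegative series is then compared coefficientwise with series of known sum. The growth (x)_n ≈
n! (n+1)^(x-1) makes rising factorials with balanced parameters interchangeable, and Bailey's series
turns out comparable to (1-η)^(-α-1/2) (1-ξ)^(-β-1/2) (1-ξ-η)^(-1) (`exists_baileySum_upper`,
`exists_baileySum_lower`). The hypothesis α, β ≥ -1/2 makes α + 1/2 and β + 1/2 nonnegative. The
powers of cosh(t/2) cancel and `kernelModel` remains. Both asserted estimates are elementary bounds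
for this expression. -/

noncomputable section

namespace JacobiPoisson

/-! ### Growth of rising factorials -/

section

open Finset Filter Topology

/-- The rising factorial `x (x+1) ⋯ (x+n-1)`. -/
def poch (x : ℝ) (n : ℕ) : ℝ := ∏ i ∈ range n, (x + i)

@[simp] lemma poch_zero (x : ℝ) : poch x 0 = 1 := by simp [poch]

lemma poch_succ (x : ℝ) (n : ℕ) : poch x (n + 1) = poch x n * (x + n) := prod_range_succ _ _

lemma poch_add (x : ℝ) (m n : ℕ) : poch x (m + n) = poch x m * poch (x + m) n := by
  induction n with
  | zero => simp
  | succ n ih => rw [← add_assoc, poch_succ, poch_succ, ih]; push_cast; ring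

lemma poch_succ' (x : ℝ) (n : ℕ) : poch x (n + 1) = x * poch (x + 1) n := by
  rw [add_comm, poch_add, poch_succ]; simp

lemma poch_pos {x : ℝ} (hx : 0 < x) (n : ℕ) : 0 < poch x n :=
  prod_pos fun i _ => by positivity

lemma poch_nonneg {x : ℝ} (hx : 0 ≤ x) (n : ℕ) : 0 ≤ poch x n :=
  prod_nonneg fun i _ => by positivity

lemma poch_mono {x y : ℝ} (hx : 0 ≤ x) (hxy : x ≤ y) (n : ℕ) : poch x n ≤ poch y n :=
  prod_le_prod (fun i _ => by positivity) fun i _ => by linarith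

lemma poch_one (n : ℕ) : poch 1 n = n.factorial := by
  induction n with
  | zero => simp
  | succ n ih => rw [poch_succ, ih, Nat.factorial_succ]; push_cast; ring

lemma poch_two_mul (x : ℝ) (n : ℕ) :
    poch x (2 * n) = 4 ^ n * (poch (x / 2) n * poch ((x + 1) / 2) n) := by
  induction n with
  | zero => simp
  | succ n ih =>
    rw [show 2 * (n + 1) = 2 * n + 1 + 1 by ring, poch_succ, poch_succ, poch_succ, poch_succ, ih]
    push_cast; ring

lemma poch_neg_natCast {n m : ℕ} (h : m ≤ n) :
    poch (-(n : ℝ)) m = (-1) ^ m * ((n.factorial : ℝ) / ((n - m).factorial : ℝ)) := by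
  induction m with
  | zero => simp [div_self, Nat.factorial_ne_zero]
  | succ m ih =>
    obtain ⟨k, rfl⟩ := Nat.exists_eq_add_of_le h
    have h1 : m + 1 + k - m = k + 1 := by omega
    have h2 : m + 1 + k - (m + 1) = k := by omega
    rw [poch_succ, ih (by omega), h1, h2, Nat.factorial_succ k]
    have : (k.factorial : ℝ) ≠ 0 := by exact_mod_cast k.factorial_ne_zero
    push_cast
    field_simp
    ring

/-- A positive sequence with a positive limit is bounded above and away from zero. -/
lemma exists_bounds_of_tendsto {f : ℕ → ℝ} {l : ℝ} (hf : ∀ n, 0 < f n) (hl : 0 < l)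
    (h : Tendsto f atTop (𝓝 l)) : ∃ C, 0 < C ∧ ∀ n, f n ≤ C ∧ 1 ≤ C * f n := by
  obtain ⟨A, hA⟩ := h.bddAbove_range
  obtain ⟨B, hB⟩ := (h.inv₀ hl.ne').bddAbove_range
  have hA' : ∀ n, f n ≤ A := fun n => hA ⟨n, rfl⟩
  have hB' : ∀ n, (f n)⁻¹ ≤ B := fun n => hB ⟨n, rfl⟩
  have hApos : 0 < A := (hf 0).trans_le (hA' 0)
  refine ⟨max A B, lt_max_of_lt_left hApos, fun n => ⟨(hA' n).trans (le_max_left _ _), ?_⟩⟩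
  calc (1 : ℝ) = (f n)⁻¹ * f n := (inv_mul_cancel₀ (hf n).ne').symm
    _ ≤ max A B * f n :=
      mul_le_mul_of_nonneg_right ((hB' n).trans (le_max_right _ _)) (hf n).le

/-- This is Gauss's limit for Γ. The base n + 1 in place of n keeps the normalizer positive at n =
0, so that the resulting bounds hold for every n. -/
lemma tendsto_poch_div (x : ℝ) (hx : 0 < x) :
    Tendsto (fun n : ℕ => poch x n / (n.factorial * ((n : ℝ) + 1) ^ (x - 1))) atTop
      (𝓝 (Real.Gamma x)⁻¹) := by
  have h1 := (Real.GammaSeq_tendsto_Gamma x).inv₀ (Real.Gamma_pos_of_pos hx).ne'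
  have h2 : Tendsto (fun n : ℕ => ((n : ℝ) / (n + 1))) atTop (𝓝 1) :=
    tendsto_natCast_div_add_atTop (1 : ℝ)
  have h3 : Tendsto (fun n : ℕ => ((n : ℝ) / (n + x))) atTop (𝓝 1) :=
    tendsto_natCast_div_add_atTop x
  have h4 : Tendsto (fun n : ℕ => ((n : ℝ) / (n + 1)) ^ (x - 1) * ((n : ℝ) / (n + x))) atTop
      (𝓝 1) := by
    have := (h2.rpow_const (p := x - 1) (Or.inl one_ne_zero)).mul h3
    simpa using this
  have h5 := h1.mul h4
  rw [mul_one] at h5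
  refine h5.congr' ?_
  filter_upwards [eventually_ge_atTop 1] with n hn
  have hn0 : (0 : ℝ) < n := by exact_mod_cast hn
  have hG : Real.GammaSeq x n = (n : ℝ) ^ x * n.factorial / (poch x n * (x + n)) := by
    rw [← poch_succ]; rfl
  have hp := poch_pos hx n
  have hf : (0 : ℝ) < n.factorial := by exact_mod_cast n.factorial_pos
  rw [hG, Real.div_rpow hn0.le (by positivity), Real.rpow_sub_one hn0.ne' x]
  have h6 : (0 : ℝ) < (n : ℝ) ^ x := Real.rpow_pos_of_pos hn0 _
  have h7 : (0 : ℝ) < ((n : ℝ) + 1) ^ (x - 1) := Real.rpow_pos_of_pos (by positivity) _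
  field_simp
  ring

/-- The rising factorial `(x)_n` is comparable with `n! (n+1)^(x-1)`. -/
lemma exists_poch_bounds {x : ℝ} (hx : 0 < x) : ∃ C, 0 < C ∧ ∀ n : ℕ,
    poch x n ≤ C * (n.factorial * ((n : ℝ) + 1) ^ (x - 1)) ∧
      n.factorial * ((n : ℝ) + 1) ^ (x - 1) ≤ C * poch x n := by
  have hd : ∀ n : ℕ, 0 < (n.factorial : ℝ) * ((n : ℝ) + 1) ^ (x - 1) := fun n =>
    mul_pos (by exact_mod_cast n.factorial_pos) (Real.rpow_pos_of_pos (by positivity) _)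
  obtain ⟨C, hC, h⟩ := exists_bounds_of_tendsto (fun n => div_pos (poch_pos hx n) (hd n))
    (inv_pos.2 (Real.Gamma_pos_of_pos hx)) (tendsto_poch_div x hx)
  refine ⟨C, hC, fun n => ⟨?_, ?_⟩⟩
  · exact (div_le_iff₀ (hd n)).1 (h n).1
  · have := (h n).2
    rwa [← mul_div_assoc, one_le_div (hd n)] at this

/-- Products of two rising factorials with equal parameter sums are comparable. -/
lemma exists_poch_mul_le {x y z w : ℝ} (hx : 0 < x) (hy : 0 < y) (hz : 0 < z) (hw : 0 < w)
    (h : x + y = z + w) :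
    ∃ C, 0 < C ∧ ∀ n, poch x n * poch y n ≤ C * (poch z n * poch w n) := by
  obtain ⟨C₁, hC₁, h₁⟩ := exists_poch_bounds hx
  obtain ⟨C₂, hC₂, h₂⟩ := exists_poch_bounds hy
  obtain ⟨C₃, hC₃, h₃⟩ := exists_poch_bounds hz
  obtain ⟨C₄, hC₄, h₄⟩ := exists_poch_bounds hw
  refine ⟨C₁ * C₂ * (C₃ * C₄), by positivity, fun n => ?_⟩
  have hn : (0 : ℝ) < (n : ℝ) + 1 := by positivity
  have key : ((n : ℝ) + 1) ^ (x - 1) * ((n : ℝ) + 1) ^ (y - 1) =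
      ((n : ℝ) + 1) ^ (z - 1) * ((n : ℝ) + 1) ^ (w - 1) := by
    rw [← Real.rpow_add hn, ← Real.rpow_add hn]; congr 1; linarith
  calc poch x n * poch y n
      ≤ (C₁ * (n.factorial * ((n : ℝ) + 1) ^ (x - 1))) *
          (C₂ * (n.factorial * ((n : ℝ) + 1) ^ (y - 1))) :=
        mul_le_mul (h₁ n).1 (h₂ n).1 (poch_pos hy n).le (by positivity)
    _ = C₁ * C₂ * (n.factorial * n.factorial *
          (((n : ℝ) + 1) ^ (x - 1) * ((n : ℝ) + 1) ^ (y - 1))) := by ring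
    _ = C₁ * C₂ * ((n.factorial * ((n : ℝ) + 1) ^ (z - 1)) *
          (n.factorial * ((n : ℝ) + 1) ^ (w - 1))) := by rw [key]; ring
    _ ≤ C₁ * C₂ * ((C₃ * poch z n) * (C₄ * poch w n)) := by
        refine mul_le_mul_of_nonneg_left ?_ (by positivity)
        exact mul_le_mul (h₃ n).2 (h₄ n).2 (by positivity)
          (mul_nonneg hC₃.le (poch_pos hz n).le)
    _ = C₁ * C₂ * (C₃ * C₄) * (poch z n * poch w n) := by ring

/-! ### Binomial series and Vandermonde convolution -/

/-- The coefficients of the binomial series `(1-z)^(-s)`. -/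
def rbin (s : ℝ) (n : ℕ) : ℝ := poch s n / n.factorial

lemma rbin_nonneg {s : ℝ} (hs : 0 ≤ s) (n : ℕ) : 0 ≤ rbin s n :=
  div_nonneg (poch_nonneg hs n) (by positivity)

lemma rbin_pos {s : ℝ} (hs : 0 < s) (n : ℕ) : 0 < rbin s n :=
  div_pos (poch_pos hs n) (by exact_mod_cast n.factorial_pos)

lemma factorial_mul_choose (r : ℝ) (n : ℕ) :
    (n.factorial : ℝ) * Ring.choose r n = ∏ i ∈ range n, (r - i) := by
  rw [← nsmul_eq_mul, ← Ring.descPochhammer_eq_factorial_smul_choose]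
  induction n with
  | zero => simp
  | succ n ih =>
    rw [descPochhammer_succ_right, Polynomial.smeval_mul, ih, prod_range_succ]
    simp [Polynomial.smeval_sub, Polynomial.smeval_natCast]

lemma choose_neg_eq_rbin (s : ℝ) (n : ℕ) : Ring.choose (-s) n = (-1) ^ n * rbin s n := by
  have h := factorial_mul_choose (-s) n
  have hf : (n.factorial : ℝ) ≠ 0 := by exact_mod_cast n.factorial_ne_zero
  have h2 : ∏ i ∈ range n, (-s - (i : ℝ)) = (-1) ^ n * poch s n := by
    rw [poch, ← card_range n, ← prod_const, card_range, ← prod_mul_distrib]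
    exact prod_congr rfl fun i _ => by ring
  rw [h2] at h
  rw [rbin, ← mul_div_assoc, eq_div_iff hf, mul_comm]
  exact h

/-- The Chu–Vandermonde identity for rising factorials. -/
lemma rbin_add (s t : ℝ) (n : ℕ) :
    rbin (s + t) n = ∑ ij ∈ antidiagonal n, rbin s ij.1 * rbin t ij.2 := by
  have h := Ring.add_choose_eq n (Commute.all (-s) (-t))
  rw [← neg_add, choose_neg_eq_rbin] at h
  have h1 : ((-1 : ℝ) ^ n) * (-1) ^ n = 1 := by rw [← mul_pow]; simp
  calc rbin (s + t) n = (-1) ^ n * ((-1) ^ n * rbin (s + t) n) := by rw [← mul_assoc, h1, one_mul]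
    _ = _ := by
      rw [h, mul_sum]
      refine sum_congr rfl fun ij hij => ?_
      rw [choose_neg_eq_rbin, choose_neg_eq_rbin, ← mem_antidiagonal.1 hij, pow_add]
      have h2 : ((-1 : ℝ) ^ ij.1) * (-1) ^ ij.1 = 1 := by rw [← mul_pow]; simp
      have h3 : ((-1 : ℝ) ^ ij.2) * (-1) ^ ij.2 = 1 := by rw [← mul_pow]; simp
      linear_combination (rbin s ij.1 * rbin t ij.2) * (-1) ^ ij.2 * (-1) ^ ij.2 * h2 +
        (rbin s ij.1 * rbin t ij.2) * h3

/-- The binomial series `∑ (s)_n z^n / n! = (1-z)^(-s)`. -/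
lemma hasSum_rbin (s : ℝ) {z : ℝ} (hz : |z| < 1) :
    HasSum (fun n => rbin s n * z ^ n) ((1 - z) ^ (-s)) := by
  have h := (Real.one_add_rpow_hasFPowerSeriesOnBall_zero (a := -s)).hasSum
    (y := -z) (by simpa [enorm_eq_nnnorm] using! hz)
  rw [zero_add, ← sub_eq_add_neg] at h
  have hterm : (fun n => rbin s n * z ^ n) = fun n => binomialSeries ℝ (-s) n fun _ => -z := by
    funext n
    simp only [binomialSeries_apply, List.ofFn_const, List.prod_replicate, smul_eq_mul]
    rw [choose_neg_eq_rbin, neg_pow z]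
    have h1 : ((-1 : ℝ) ^ n) * (-1) ^ n = 1 := by rw [← mul_pow]; simp
    linear_combination -(rbin s n * z ^ n) * h1
  rw [hterm]
  exact h

lemma hasSum_prod_of_nonneg {f : ℕ × ℕ → ℝ} (hf : ∀ p, 0 ≤ f p) {g : ℕ → ℝ} {s : ℝ}
    (h : ∀ i, HasSum (fun j => f (i, j)) (g i)) (hg : HasSum g s) : HasSum f s := by
  have hs : Summable f := by
    rw [summable_prod_of_nonneg hf]
    refine ⟨fun i => (h i).summable, ?_⟩
    simpa only [fun i => (h i).tsum_eq] using hg.summable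
  rw [hg.unique (hs.hasSum.prod_fiberwise h)]
  exact hs.hasSum

/-! ### Bailey's double series and its comparison series -/

/-- The reciprocal weights `1 / (m! (α+1)_m)`. -/
def jw (α : ℝ) (m : ℕ) : ℝ := (m.factorial * poch (α + 1) m)⁻¹

lemma jw_nonneg {α : ℝ} (hα : -1 < α) (m : ℕ) : 0 ≤ jw α m :=
  inv_nonneg.2 (mul_nonneg (by positivity) (poch_nonneg (by linarith) m))

/-- The terms of Bailey's double series. -/
def baileyTerm (α β ξ η : ℝ) (p : ℕ × ℕ) : ℝ :=
  poch (α + β + 2) (2 * (p.1 + p.2)) / 4 ^ (p.1 + p.2) * (jw α p.1 * jw β p.2) *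
    (ξ ^ (2 * p.1) * η ^ (2 * p.2))

lemma baileyTerm_nonneg {α β : ℝ} (hα : -1 < α) (hβ : -1 < β) (ξ η : ℝ) (p : ℕ × ℕ) :
    0 ≤ baileyTerm α β ξ η p := by
  unfold baileyTerm
  have := jw_nonneg hα p.1
  have := jw_nonneg hβ p.2
  have : 0 ≤ poch (α + β + 2) (2 * (p.1 + p.2)) := poch_nonneg (by linarith) _
  rw [pow_mul, pow_mul]
  positivity

lemma baileyTerm_swap (α β ξ η : ℝ) (p : ℕ × ℕ) :
    baileyTerm β α η ξ p.swap = baileyTerm α β ξ η p := by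
  simp only [baileyTerm, Prod.fst_swap, Prod.snd_swap, add_comm p.2, add_comm β α]
  ring

/-- Duplication splits (α+3/2)_{2m} into 4^m times two rising factorials of index m, whose
parameters add up to α + 2 = 1 + (α + 1). Thus m! (α+1)_m can be traded for a single rising
factorial of even index, and Bailey's series becomes the even part of a more tractable one. -/
lemma exists_jw_bounds {α : ℝ} (hα : -(1 / 2) ≤ α) : ∃ C, 0 < C ∧ ∀ m : ℕ,
    jw α m / 4 ^ m ≤ C * (poch (α + 3 / 2) (2 * m))⁻¹ ∧
      (poch (α + 3 / 2) (2 * m))⁻¹ ≤ C * (jw α m / 4 ^ m) := by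
  obtain ⟨C₁, hC₁, h₁⟩ := exists_poch_mul_le (x := (α + 3 / 2) / 2) (y := (α + 3 / 2 + 1) / 2)
    (z := 1) (w := α + 1) (by linarith) (by linarith) (by linarith) (by linarith) (by ring)
  obtain ⟨C₂, hC₂, h₂⟩ := exists_poch_mul_le (z := (α + 3 / 2) / 2) (w := (α + 3 / 2 + 1) / 2)
    (x := 1) (y := α + 1) (by linarith) (by linarith) (by linarith) (by linarith) (by ring)
  refine ⟨max C₁ C₂, lt_max_of_lt_left hC₁, fun m => ?_⟩
  have p1 : 0 < poch (α + 3 / 2) (2 * m) := poch_pos (by linarith) _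
  have p2 : 0 < poch (α + 1) m := poch_pos (by linarith) _
  have p3 : (0 : ℝ) < m.factorial := by exact_mod_cast m.factorial_pos
  have e : jw α m / 4 ^ m = (4 ^ m * (m.factorial * poch (α + 1) m))⁻¹ := by
    rw [jw, mul_inv (4 ^ m : ℝ), div_eq_mul_inv, mul_comm]
  have h1 := h₁ m
  have h2 := h₂ m
  rw [poch_one] at h1 h2
  have p4 := poch_two_mul (α + 3 / 2) m
  have hA : poch (α + 3 / 2) (2 * m) ≤ max C₁ C₂ * (4 ^ m * (m.factorial * poch (α + 1) m)) := by
    rw [p4, mul_left_comm (max C₁ C₂)]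
    refine mul_le_mul_of_nonneg_left (h1.trans ?_) (by positivity)
    exact mul_le_mul_of_nonneg_right (le_max_left _ _) (by positivity)
  have hB : 4 ^ m * (m.factorial * poch (α + 1) m) ≤ max C₁ C₂ * poch (α + 3 / 2) (2 * m) := by
    have : 0 < poch ((α + 3 / 2) / 2) m * poch ((α + 3 / 2 + 1) / 2) m :=
      mul_pos (poch_pos (by linarith) _) (poch_pos (by linarith) _)
    rw [p4, mul_left_comm (max C₁ C₂)]
    refine mul_le_mul_of_nonneg_left (h2.trans ?_) (by positivity)
    exact mul_le_mul_of_nonneg_right (le_max_right _ _) this.le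
  rw [e]
  constructor
  · rw [← div_eq_mul_inv, le_div_iff₀ p1, inv_mul_le_iff₀ (by positivity), mul_comm _ (max C₁ C₂)]
    exact hA
  · rw [← div_eq_mul_inv, le_div_iff₀ (by positivity), inv_mul_le_iff₀ p1, mul_comm _ (max C₁ C₂)]
    exact hB

/-- Terms of the expansion of `(1-ξ)^(-b) (1-ξ-η)^(-1)` (the power of `η` is the first index). -/
def geomTerm (b ξ η : ℝ) (p : ℕ × ℕ) : ℝ := η ^ p.1 * (rbin (b + 1 + p.1) p.2 * ξ ^ p.2)

lemma geomTerm_nonneg {b ξ η : ℝ} (hb : 0 ≤ b) (hξ : 0 ≤ ξ) (hη : 0 ≤ η) (p : ℕ × ℕ) :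
    0 ≤ geomTerm b ξ η p := by
  have : 0 ≤ rbin (b + 1 + p.1) p.2 := rbin_nonneg (by positivity) _
  unfold geomTerm
  positivity

lemma rpow_neg_add_natCast_mul {x : ℝ} (hx : 0 < x) (b y : ℝ) (j : ℕ) :
    y ^ j * x ^ (-(b + 1 + j)) = x ^ (-b) * x⁻¹ * (y / x) ^ j := by
  rw [neg_add, neg_add, Real.rpow_add hx, Real.rpow_add hx, Real.rpow_neg_one,
    Real.rpow_neg hx.le, Real.rpow_neg hx.le, Real.rpow_natCast, div_pow]
  field_simp

/-- Summation over the power of ξ gives η^j (1-ξ)^(-(b+1+j)), which is geometric in j with ratio η /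
(1-ξ). -/
lemma hasSum_geomTerm {b ξ η : ℝ} (hb : 0 ≤ b) (hξ : 0 ≤ ξ) (hη : 0 ≤ η) (h : ξ + η < 1) :
    HasSum (geomTerm b ξ η) ((1 - ξ) ^ (-b) * (1 - ξ - η)⁻¹) := by
  have h1 : 0 < 1 - ξ := by linarith
  have h2 : 0 < 1 - ξ - η := by linarith
  refine hasSum_prod_of_nonneg (geomTerm_nonneg hb hξ hη)
    (g := fun j : ℕ => (1 - ξ) ^ (-b) * (1 - ξ)⁻¹ * (η / (1 - ξ)) ^ j) (fun j => ?_) ?_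
  · rw [← rpow_neg_add_natCast_mul h1]
    exact (hasSum_rbin _ (by rw [abs_of_nonneg hξ]; linarith)).mul_left _
  · have := (hasSum_geometric_of_lt_one (r := η / (1 - ξ)) (by positivity)
      (by rw [div_lt_one h1]; linarith)).mul_left ((1 - ξ) ^ (-b) * (1 - ξ)⁻¹)
    have e : (1 - ξ) ^ (-b) * (1 - ξ)⁻¹ * (1 - η / (1 - ξ))⁻¹ =
        (1 - ξ) ^ (-b) * (1 - ξ - η)⁻¹ := by
      rw [mul_assoc, ← mul_inv]
      congr 2
      field_simp
    rwa [e] at this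

/-- Both sides equal (b+1)_{i+j} / (i! (b+1)_j). This allows the same double series to be read with
either index outermost. -/
lemma rbin_mul_poch_div {b : ℝ} (hb : 0 ≤ b) (i j : ℕ) :
    rbin (b + 1) i * (poch (b + 1 + i) j / poch (b + 1) j) = rbin (b + 1 + j) i := by
  have h := poch_add (b + 1) i j
  rw [add_comm i j, poch_add] at h
  have := poch_pos (x := b + 1) (by linarith) j
  unfold rbin
  field_simp
  linarith

/-- Consecutive ratios are (n+1) / (b+1+n), at most 1 because b ≥ 0. -/
lemma factorial_div_poch_antitone {b : ℝ} (hb : 0 ≤ b) (i j : ℕ) :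
    ((i + j).factorial : ℝ) / poch (b + 1) (i + j) ≤ j.factorial / poch (b + 1) j := by
  induction i with
  | zero => simp
  | succ i ih =>
    refine le_trans ?_ ih
    have p := poch_pos (x := b + 1) (by linarith) (i + j)
    rw [add_right_comm i 1 j, poch_succ, Nat.factorial_succ, mul_comm (poch _ _)]
    push_cast
    rw [mul_div_mul_comm]
    refine mul_le_of_le_one_left (by positivity) ?_
    rw [div_le_one (by positivity)]
    linarith

/-- The terms of the hypergeometric series `₂F₁(1, s; b+1; η)`. -/
def hyperTerm (s b η : ℝ) (j : ℕ) : ℝ := poch s j / poch (b + 1) j * η ^ j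

lemma hyperTerm_nonneg {s b η : ℝ} (hs : 0 ≤ s) (hb : 0 ≤ b) (hη : 0 ≤ η) (j : ℕ) :
    0 ≤ hyperTerm s b η j :=
  mul_nonneg (div_nonneg (poch_nonneg hs _) (poch_nonneg (by positivity) _)) (by positivity)

lemma hyperTerm_eq_rbin (s b η : ℝ) (j : ℕ) :
    hyperTerm s b η j = rbin s j * (j.factorial / poch (b + 1) j * η ^ j) := by
  have hf : (j.factorial : ℝ) ≠ 0 := by exact_mod_cast j.factorial_ne_zero
  rw [hyperTerm, rbin, ← mul_assoc, ← mul_div_assoc, div_mul_cancel₀ _ hf]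

/-- Vandermonde splits the coefficient with parameter a + s, and the remaining weight j! / (b+1)_j
only grows when j is replaced by the smaller index. An extra parameter a therefore costs at most a
Cauchy product with the series of (1-η)^(-a). -/
lemma hyperTerm_add_le {a s b η : ℝ} (ha : 0 ≤ a) (hs : 0 ≤ s) (hb : 0 ≤ b) (hη : 0 ≤ η) (j : ℕ) :
    hyperTerm (a + s) b η j ≤
      ∑ kl ∈ antidiagonal j, (rbin a kl.1 * η ^ kl.1) * hyperTerm s b η kl.2 := by
  rw [hyperTerm_eq_rbin, rbin_add, sum_mul]
  refine sum_le_sum fun kl hkl => ?_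
  rw [← mem_antidiagonal.1 hkl, hyperTerm_eq_rbin, pow_add]
  have h1 := factorial_div_poch_antitone hb kl.1 kl.2
  have h2 := mul_nonneg (mul_nonneg (rbin_nonneg ha kl.1) (rbin_nonneg hs kl.2))
    (mul_nonneg (pow_nonneg hη kl.1) (pow_nonneg hη kl.2))
  have h3 := mul_le_mul_of_nonneg_left h1 h2
  linarith

lemma tsum_le_mul_of_le_antidiagonal {f g u : ℕ → ℝ} (hf : Summable f) (hg : Summable g)
    (hf0 : 0 ≤ f) (hg0 : 0 ≤ g) (hu0 : 0 ≤ u)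
    (hu : ∀ j, u j ≤ ∑ kl ∈ antidiagonal j, f kl.1 * g kl.2) :
    Summable u ∧ ∑' j, u j ≤ (∑' j, f j) * ∑' j, g j := by
  have hprod := hf.mul_of_nonneg hg hf0 hg0
  have hanti := summable_sum_mul_antidiagonal_of_summable_mul hprod
  have hs : Summable u := Summable.of_nonneg_of_le hu0 hu hanti
  exact ⟨hs, (hs.tsum_le_tsum hu hanti).trans_eq
    (hf.tsum_mul_tsum_eq_tsum_sum_antidiagonal hg hprod).symm⟩

lemma hyperTerm_add_bound {a s b η : ℝ} (ha : 0 ≤ a) (hs : 0 ≤ s) (hb : 0 ≤ b) (hη : 0 ≤ η)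
    (hη1 : η < 1) (h : Summable (hyperTerm s b η)) :
    Summable (hyperTerm (a + s) b η) ∧
      ∑' j, hyperTerm (a + s) b η j ≤ (1 - η) ^ (-a) * ∑' j, hyperTerm s b η j := by
  have hA := hasSum_rbin a (z := η) (by rwa [abs_of_nonneg hη])
  rw [← hA.tsum_eq]
  exact tsum_le_mul_of_le_antidiagonal hA.summable h
    (fun j => mul_nonneg (rbin_nonneg ha j) (pow_nonneg hη j)) (hyperTerm_nonneg hs hb hη)
    (hyperTerm_nonneg (add_nonneg ha hs) hb hη) (hyperTerm_add_le ha hs hb hη)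

/-- The double series majorizing Bailey's series. -/
def majorTerm (a b ξ η : ℝ) (p : ℕ × ℕ) : ℝ :=
  rbin (b + 1) p.1 * ξ ^ p.1 * hyperTerm (a + (b + 1 + p.1)) b η p.2

lemma majorTerm_nonneg {a b ξ η : ℝ} (ha : 0 ≤ a) (hb : 0 ≤ b) (hξ : 0 ≤ ξ) (hη : 0 ≤ η)
    (p : ℕ × ℕ) : 0 ≤ majorTerm a b ξ η p :=
  mul_nonneg (mul_nonneg (rbin_nonneg (by positivity) _) (by positivity))
    (hyperTerm_nonneg (by positivity) hb hη _)

lemma majorTerm_zero_swap (b ξ η : ℝ) (hb : 0 ≤ b) (p : ℕ × ℕ) :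
    geomTerm b ξ η p.swap = majorTerm 0 b ξ η p := by
  simp only [geomTerm, majorTerm, hyperTerm, Prod.fst_swap, Prod.snd_swap, zero_add]
  rw [← rbin_mul_poch_div hb]
  ring

/-- For a = 0 this is `geomTerm` with its indices exchanged, whose sum is known. Raising a
multiplies each inner sum over the powers of η by at most (1-η)^(-a), uniformly in the outer index,
so the factor comes out. -/
lemma majorTerm_bound {a b ξ η : ℝ} (ha : 0 ≤ a) (hb : 0 ≤ b) (hξ : 0 ≤ ξ) (hη : 0 ≤ η)
    (h : ξ + η < 1) : Summable (majorTerm a b ξ η) ∧ ∑' p, majorTerm a b ξ η p ≤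
      (1 - η) ^ (-a) * ((1 - ξ) ^ (-b) * (1 - ξ - η)⁻¹) := by
  have hη1 : η < 1 := by linarith
  have hG : HasSum (majorTerm 0 b ξ η) ((1 - ξ) ^ (-b) * (1 - ξ - η)⁻¹) := by
    have := (Equiv.prodComm ℕ ℕ).hasSum_iff.2 (hasSum_geomTerm hb hξ hη h)
    rwa [show geomTerm b ξ η ∘ Equiv.prodComm ℕ ℕ = majorTerm 0 b ξ η from
      funext fun p => majorTerm_zero_swap b ξ η hb p] at this
  have hfac : ∀ i : ℕ, Summable (fun j => majorTerm a b ξ η (i, j)) ∧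
      ∑' j, majorTerm a b ξ η (i, j) ≤ (1 - η) ^ (-a) * ∑' j : ℕ, majorTerm 0 b ξ η (i, j) := by
    intro i
    have h0 : 0 ≤ rbin (b + 1) i * ξ ^ i :=
      mul_nonneg (rbin_nonneg (by linarith) i) (by positivity)
    have h1 := hG.summable.prod_factor i
    -- When the outer coefficient vanishes, the inner summability cannot be recovered by dividing it
    -- out, but the claim is then trivial.
    by_cases hz : rbin (b + 1) i * ξ ^ i = 0
    · simp [majorTerm, hz, summable_zero]
    · simp only [majorTerm, zero_add] at h1 ⊢
      obtain ⟨h3, h4⟩ := hyperTerm_add_bound ha (s := b + 1 + i) (by positivity) hb hη hη1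
        ((summable_mul_left_iff hz).1 h1)
      refine ⟨h3.mul_left _, ?_⟩
      rw [tsum_mul_left, tsum_mul_left, mul_left_comm]
      exact mul_le_mul_of_nonneg_left h4 h0
  have hGs := hG.summable.prod.mul_left ((1 - η) ^ (-a))
  have hout : Summable fun i => ∑' j, majorTerm a b ξ η (i, j) :=
    Summable.of_nonneg_of_le (fun i => tsum_nonneg fun j => majorTerm_nonneg ha hb hξ hη _)
      (fun i => (hfac i).2) hGs
  have hS : Summable (majorTerm a b ξ η) :=
    (summable_prod_of_nonneg (majorTerm_nonneg ha hb hξ hη)).2 ⟨fun i => (hfac i).1, hout⟩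
  refine ⟨hS, ?_⟩
  rw [hS.tsum_prod, ← hG.tsum_eq, hG.summable.tsum_prod, ← tsum_mul_left]
  exact hout.tsum_le_tsum (fun i => (hfac i).2) hGs

lemma baileyTerm_eq (α β ξ η : ℝ) (m k : ℕ) :
    baileyTerm α β ξ η (m, k) = poch (α + β + 2) (2 * m) * poch (α + β + 2 + (2 * m : ℕ)) (2 * k) *
      ((jw α m / 4 ^ m) * (jw β k / 4 ^ k)) * (ξ ^ (2 * m) * η ^ (2 * k)) := by
  rw [← poch_add, ← mul_add]
  simp only [baileyTerm, pow_add]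
  field_simp

/-- `exists_jw_bounds` treats each weight. The balance (α+β+2) + 1 = (α+3/2) + (β+3/2) then trades
(α+β+2)_{2m} / (α+3/2)_{2m} for (β+3/2)_{2m} / (2m)!. Bailey's terms are thereby dominated by the
terms of the majorant with both indices even. -/
lemma exists_baileyTerm_le_majorTerm {α β : ℝ} (hα : -(1 / 2) ≤ α) (hβ : -(1 / 2) ≤ β) :
    ∃ C, 0 < C ∧ ∀ ξ η : ℝ, 0 ≤ ξ → 0 ≤ η → ∀ m k : ℕ,
      baileyTerm α β ξ η (m, k) ≤ C * majorTerm (α + 1 / 2) (β + 1 / 2) ξ η (2 * m, 2 * k) := by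
  obtain ⟨C₁, hC₁, h₁⟩ := exists_jw_bounds hα
  obtain ⟨C₂, hC₂, h₂⟩ := exists_jw_bounds hβ
  obtain ⟨C₃, hC₃, h₃⟩ := exists_poch_mul_le (x := α + β + 2) (y := 1) (z := α + 3 / 2)
    (w := β + 3 / 2) (by linarith) (by linarith) (by linarith) (by linarith) (by ring)
  refine ⟨C₃ * (C₁ * C₂), by positivity, fun ξ η hξ hη m k => ?_⟩
  have hL : 0 ≤ poch (α + β + 2 + (2 * m : ℕ)) (2 * k) :=
    poch_nonneg (add_nonneg (by linarith) (Nat.cast_nonneg _)) _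
  have hA : 0 ≤ poch (α + β + 2) (2 * m) := poch_nonneg (by linarith) _
  have hPa : 0 < poch (α + 3 / 2) (2 * m) := poch_pos (by linarith) _
  have hPb : 0 < poch (β + 3 / 2) (2 * k) := poch_pos (by linarith) _
  have hV : 0 ≤ jw β k / 4 ^ k := div_nonneg (jw_nonneg (by linarith) _) (by positivity)
  have hf : (0 : ℝ) < (2 * m).factorial := by exact_mod_cast (2 * m).factorial_pos
  have h3 := h₃ (2 * m)
  rw [poch_one] at h3
  have h3' : poch (α + β + 2) (2 * m) * (poch (α + 3 / 2) (2 * m))⁻¹ ≤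
      C₃ * rbin (β + 3 / 2) (2 * m) := by
    rw [rbin, ← mul_div_assoc, le_div_iff₀ hf, ← div_eq_mul_inv, div_mul_eq_mul_div,
      div_le_iff₀ hPa]
    linarith
  have hUV := mul_le_mul (h₁ m).1 (h₂ k).1 hV (by positivity)
  rw [baileyTerm_eq, majorTerm, hyperTerm]
  simp only
  rw [show α + 1 / 2 + (β + 1 / 2 + 1 + ((2 * m : ℕ) : ℝ)) = α + β + 2 + (2 * m : ℕ) by ring,
    show β + 1 / 2 + 1 = β + 3 / 2 by ring]
  calc poch (α + β + 2) (2 * m) * poch (α + β + 2 + (2 * m : ℕ)) (2 * k) *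
        ((jw α m / 4 ^ m) * (jw β k / 4 ^ k)) * (ξ ^ (2 * m) * η ^ (2 * k))
      ≤ poch (α + β + 2) (2 * m) * poch (α + β + 2 + (2 * m : ℕ)) (2 * k) *
        ((C₁ * (poch (α + 3 / 2) (2 * m))⁻¹) * (C₂ * (poch (β + 3 / 2) (2 * k))⁻¹)) *
        (ξ ^ (2 * m) * η ^ (2 * k)) := by gcongr
    _ = (poch (α + β + 2) (2 * m) * (poch (α + 3 / 2) (2 * m))⁻¹) *
        ((C₁ * C₂) * (poch (α + β + 2 + (2 * m : ℕ)) (2 * k) * (poch (β + 3 / 2) (2 * k))⁻¹) *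
        (ξ ^ (2 * m) * η ^ (2 * k))) := by ring
    _ ≤ (C₃ * rbin (β + 3 / 2) (2 * m)) *
        ((C₁ * C₂) * (poch (α + β + 2 + (2 * m : ℕ)) (2 * k) * (poch (β + 3 / 2) (2 * k))⁻¹) *
        (ξ ^ (2 * m) * η ^ (2 * k))) := by gcongr
    _ = _ := by rw [div_eq_mul_inv]; ring

/-- The same exchanges are made in the opposite direction, and α + 1/2 ≥ 0 permits lowering the base
α + β + 2 + 2m to β + 3/2 + 2m. This gives up the factor (1-η)^(-α-1/2), which symmetry restores
later. -/
lemma exists_geomTerm_le_baileyTerm {α β : ℝ} (hα : -(1 / 2) ≤ α) (hβ : -(1 / 2) ≤ β) :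
    ∃ C, 0 < C ∧ ∀ ξ η : ℝ, 0 ≤ ξ → 0 ≤ η → ∀ m k : ℕ,
      geomTerm (β + 1 / 2) ξ η (2 * k, 2 * m) ≤ C * baileyTerm α β ξ η (m, k) := by
  obtain ⟨C₁, hC₁, h₁⟩ := exists_jw_bounds hα
  obtain ⟨C₂, hC₂, h₂⟩ := exists_jw_bounds hβ
  obtain ⟨C₃, hC₃, h₃⟩ := exists_poch_mul_le (z := α + β + 2) (w := 1) (x := α + 3 / 2)
    (y := β + 3 / 2) (by linarith) (by linarith) (by linarith) (by linarith) (by ring)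
  refine ⟨C₃ * (C₁ * C₂), by positivity, fun ξ η hξ hη m k => ?_⟩
  have hL : poch (β + 3 / 2 + (2 * m : ℕ)) (2 * k) ≤ poch (α + β + 2 + (2 * m : ℕ)) (2 * k) :=
    poch_mono (add_nonneg (by linarith) (Nat.cast_nonneg _)) (by linarith) _
  have hL0 : 0 ≤ poch (β + 3 / 2 + (2 * m : ℕ)) (2 * k) :=
    poch_nonneg (add_nonneg (by linarith) (Nat.cast_nonneg _)) _
  have hA : 0 ≤ poch (α + β + 2) (2 * m) := poch_nonneg (by linarith) _
  have hPa : 0 < poch (α + 3 / 2) (2 * m) := poch_pos (by linarith) _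
  have hPb : 0 < poch (β + 3 / 2) (2 * k) := poch_pos (by linarith) _
  have hU : 0 ≤ jw α m / 4 ^ m := div_nonneg (jw_nonneg (by linarith) _) (by positivity)
  have hf : (0 : ℝ) < (2 * m).factorial := by exact_mod_cast (2 * m).factorial_pos
  have h3 := h₃ (2 * m)
  rw [poch_one] at h3
  have h3' : rbin (β + 3 / 2) (2 * m) ≤
      C₃ * (poch (α + β + 2) (2 * m) * (poch (α + 3 / 2) (2 * m))⁻¹) := by
    rw [rbin, div_le_iff₀ hf, ← div_eq_mul_inv, mul_div_assoc', div_mul_eq_mul_div,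
      le_div_iff₀ hPa]
    linarith
  have hUV := mul_le_mul (h₁ m).2 (h₂ k).2 (by positivity) (by positivity)
  have hr : 0 ≤ rbin (β + 3 / 2) (2 * m) := rbin_nonneg (by linarith) _
  rw [baileyTerm_eq, geomTerm]
  simp only
  rw [← rbin_mul_poch_div (by linarith), show β + 1 / 2 + 1 = β + 3 / 2 by ring]
  calc η ^ (2 * k) * (rbin (β + 3 / 2) (2 * m) * (poch (β + 3 / 2 + (2 * m : ℕ)) (2 * k) /
        poch (β + 3 / 2) (2 * k)) * ξ ^ (2 * m))
      = rbin (β + 3 / 2) (2 * m) * (poch (β + 3 / 2 + (2 * m : ℕ)) (2 * k) *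
        ((poch (β + 3 / 2) (2 * k))⁻¹ * (ξ ^ (2 * m) * η ^ (2 * k)))) := by
        rw [div_eq_mul_inv]; ring
    _ ≤ (C₃ * (poch (α + β + 2) (2 * m) * (poch (α + 3 / 2) (2 * m))⁻¹)) *
        (poch (α + β + 2 + (2 * m : ℕ)) (2 * k) *
        ((poch (β + 3 / 2) (2 * k))⁻¹ * (ξ ^ (2 * m) * η ^ (2 * k)))) := by gcongr
    _ = C₃ * (poch (α + β + 2) (2 * m) * poch (α + β + 2 + (2 * m : ℕ)) (2 * k) *
        ((poch (α + 3 / 2) (2 * m))⁻¹ * (poch (β + 3 / 2) (2 * k))⁻¹) *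
        (ξ ^ (2 * m) * η ^ (2 * k))) := by ring
    _ ≤ C₃ * (poch (α + β + 2) (2 * m) * poch (α + β + 2 + (2 * m : ℕ)) (2 * k) *
        (C₁ * (jw α m / 4 ^ m) * (C₂ * (jw β k / 4 ^ k))) *
        (ξ ^ (2 * m) * η ^ (2 * k))) := by gcongr; exact mul_nonneg hA (hL0.trans hL)
    _ = _ := by ring

/-! ### Two-sided bounds for Bailey's sum -/

/-- The sum of Bailey's double series. -/
def baileySum (α β ξ η : ℝ) : ℝ := ∑' p, baileyTerm α β ξ η p

lemma baileySum_swap (α β ξ η : ℝ) : baileySum β α η ξ = baileySum α β ξ η := by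
  rw [baileySum, ← (Equiv.prodComm ℕ ℕ).tsum_eq]
  exact tsum_congr fun p => baileyTerm_swap α β ξ η p

lemma injective_two_mul_prod :
    Function.Injective fun p : ℕ × ℕ => ((2 * p.1, 2 * p.2) : ℕ × ℕ) := by
  rintro ⟨a, b⟩ ⟨c, d⟩ h
  simp only [Prod.mk.injEq] at h
  ext <;> simp <;> omega

lemma exists_baileySum_upper {α β : ℝ} (hα : -(1 / 2) ≤ α) (hβ : -(1 / 2) ≤ β) :
    ∃ C, 0 < C ∧ ∀ ξ η : ℝ, 0 ≤ ξ → 0 ≤ η → ξ + η < 1 →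
      Summable (baileyTerm α β ξ η) ∧ baileySum α β ξ η ≤
        C * ((1 - η) ^ (-(α + 1 / 2)) * ((1 - ξ) ^ (-(β + 1 / 2)) * (1 - ξ - η)⁻¹)) := by
  obtain ⟨C, hC, h⟩ := exists_baileyTerm_le_majorTerm hα hβ
  refine ⟨C, hC, fun ξ η hξ hη hlt => ?_⟩
  have ha : 0 ≤ α + 1 / 2 := by linarith
  have hb : 0 ≤ β + 1 / 2 := by linarith
  obtain ⟨hs, hb'⟩ := majorTerm_bound ha hb hξ hη hlt
  have hsub := (hs.comp_injective injective_two_mul_prod).mul_left C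
  have hle : ∀ p, baileyTerm α β ξ η p ≤
      C * (majorTerm (α + 1 / 2) (β + 1 / 2) ξ η ∘ fun p : ℕ × ℕ => (2 * p.1, 2 * p.2)) p :=
    fun p => h ξ η hξ hη p.1 p.2
  have hS := Summable.of_nonneg_of_le (baileyTerm_nonneg (by linarith) (by linarith) ξ η) hle hsub
  refine ⟨hS, (hS.tsum_le_tsum hle hsub).trans ?_⟩
  rw [tsum_mul_left]
  refine mul_le_mul_of_nonneg_left (le_trans ?_ hb') hC.le
  exact tsum_comp_le_tsum_of_inj hs (majorTerm_nonneg ha hb hξ hη) injective_two_mul_prod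

/-- The even part of a binomial series. -/
lemma hasSum_rbin_even (s : ℝ) {z : ℝ} (hz : |z| < 1) :
    HasSum (fun m => rbin s (2 * m) * z ^ (2 * m)) (((1 - z) ^ (-s) + (1 + z) ^ (-s)) / 2) := by
  have h := ((hasSum_rbin s hz).add (hasSum_rbin s (z := -z) (by rwa [abs_neg]))).div_const 2
  rw [sub_neg_eq_add] at h
  have hinj : Function.Injective fun m : ℕ => 2 * m := fun a b hab => by simpa using hab
  rw [← hinj.hasSum_iff] at h
  · have e : (fun m : ℕ => rbin s (2 * m) * z ^ (2 * m)) =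
        (fun n => (rbin s n * z ^ n + rbin s n * (-z) ^ n) / 2) ∘ fun m : ℕ => 2 * m := by
      funext m
      simp only [Function.comp_apply, (even_two_mul m).neg_pow]
      ring
    rwa [e]
  · intro n hn
    have ho : Odd n := by
      rw [← Nat.not_even_iff_odd, even_iff_two_dvd]
      rintro ⟨m, rfl⟩
      exact hn ⟨m, rfl⟩
    rw [ho.neg_pow]
    ring

/-- Keeping only even powers loses at most a factor 2 in each variable: the even part of (1-ξ)^(-c)
is at least half of it, and 1/(1-z²) is at least half of 1/(1-z) for 0 ≤ z < 1. -/
lemma geomTerm_even_lower {b ξ η : ℝ} (hb : 0 ≤ b) (hξ : 0 ≤ ξ) (hη : 0 ≤ η) (h : ξ + η < 1) :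
    Summable (fun p : ℕ × ℕ => geomTerm b ξ η (2 * p.1, 2 * p.2)) ∧
      (1 - ξ) ^ (-b) * (1 - ξ - η)⁻¹ ≤ 4 * ∑' p : ℕ × ℕ, geomTerm b ξ η (2 * p.1, 2 * p.2) := by
  have hs : Summable (fun p : ℕ × ℕ => geomTerm b ξ η (2 * p.1, 2 * p.2)) :=
    (hasSum_geomTerm hb hξ hη h).summable.comp_injective injective_two_mul_prod
  refine ⟨hs, ?_⟩
  have h1 : 0 < 1 - ξ := by linarith
  have h2 : 0 < 1 - ξ - η := by linarith
  have habs : |ξ| < 1 := by rw [abs_of_nonneg hξ]; linarith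
  have hz0 : 0 ≤ η / (1 - ξ) := by positivity
  have hz1 : η / (1 - ξ) < 1 := by rw [div_lt_one h1]; linarith
  have hin : ∀ k : ℕ, (1 - ξ) ^ (-b) * (1 - ξ)⁻¹ * ((η / (1 - ξ)) ^ 2) ^ k ≤
      2 * ∑' m, geomTerm b ξ η (2 * k, 2 * m) := by
    intro k
    have h3 := (hasSum_rbin_even (b + 1 + (2 * k : ℕ)) habs).mul_left (η ^ (2 * k))
    have h4 : ∑' m, geomTerm b ξ η (2 * k, 2 * m) = _ := h3.tsum_eq
    rw [h4, ← pow_mul, ← rpow_neg_add_natCast_mul h1]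
    have h5 : 0 ≤ (1 + ξ) ^ (-(b + 1 + (2 * k : ℕ))) := Real.rpow_nonneg (by linarith) _
    have h6 := mul_nonneg (pow_nonneg hη (2 * k)) h5
    linarith
  have hgeo := (hasSum_geometric_of_lt_one (sq_nonneg (η / (1 - ξ)))
    (pow_lt_one₀ hz0 hz1 two_ne_zero)).mul_left ((1 - ξ) ^ (-b) * (1 - ξ)⁻¹)
  have h7 := hgeo.summable.tsum_le_tsum hin (hs.prod.mul_left 2)
  rw [hgeo.tsum_eq, tsum_mul_left, ← hs.tsum_prod] at h7
  have h8 : (1 - ξ) ^ (-b) * (1 - ξ - η)⁻¹ ≤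
      2 * ((1 - ξ) ^ (-b) * (1 - ξ)⁻¹ * (1 - (η / (1 - ξ)) ^ 2)⁻¹) := by
    have e : (1 - ξ) ^ (-b) * (1 - ξ - η)⁻¹ =
        (1 - ξ) ^ (-b) * (1 - ξ)⁻¹ * (1 - η / (1 - ξ))⁻¹ := by
      rw [mul_assoc, ← mul_inv]
      congr 2
      field_simp
    have hp : 0 ≤ (1 - ξ) ^ (-b) * (1 - ξ)⁻¹ :=
      mul_nonneg (Real.rpow_nonneg h1.le _) (inv_nonneg.2 h1.le)
    rw [e, mul_left_comm]
    refine mul_le_mul_of_nonneg_left ?_ hp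
    set z := η / (1 - ξ)
    have hz2 : 0 < 1 - z := by linarith
    rw [show 1 - z ^ 2 = (1 - z) * (1 + z) by ring, mul_inv, ← div_eq_mul_inv, mul_div_assoc',
      le_div_iff₀ (by positivity)]
    have : 0 < (1 - z)⁻¹ := inv_pos.2 hz2
    nlinarith
  linarith

lemma exists_baileySum_lower_aux {α β : ℝ} (hα : -(1 / 2) ≤ α) (hβ : -(1 / 2) ≤ β) :
    ∃ C, 0 < C ∧ ∀ ξ η : ℝ, 0 ≤ ξ → 0 ≤ η → ξ + η < 1 →
      (1 - ξ) ^ (-(β + 1 / 2)) * (1 - ξ - η)⁻¹ ≤ C * baileySum α β ξ η := by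
  obtain ⟨C, hC, h⟩ := exists_geomTerm_le_baileyTerm hα hβ
  obtain ⟨_, _, hU⟩ := exists_baileySum_upper hα hβ
  refine ⟨4 * C, by positivity, fun ξ η hξ hη hlt => ?_⟩
  obtain ⟨hs, hb⟩ := geomTerm_even_lower (b := β + 1 / 2) (by linarith) hξ hη hlt
  have hS := (Equiv.prodComm ℕ ℕ).hasSum_iff.2 (hU ξ η hξ hη hlt).1.hasSum
  have hS' : HasSum (fun p : ℕ × ℕ => C * baileyTerm α β ξ η (p.2, p.1))
      (C * baileySum α β ξ η) := hS.mul_left C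
  have hle : ∀ p : ℕ × ℕ, geomTerm (β + 1 / 2) ξ η (2 * p.1, 2 * p.2) ≤
      C * baileyTerm α β ξ η (p.2, p.1) := fun p => h ξ η hξ hη p.2 p.1
  have h1 := hs.tsum_le_tsum hle hS'.summable
  rw [hS'.tsum_eq] at h1
  linarith

/-- The lower bound for the sum of Bailey's series. -/
lemma exists_baileySum_lower {α β : ℝ} (hα : -(1 / 2) ≤ α) (hβ : -(1 / 2) ≤ β) :
    ∃ C, 0 < C ∧ ∀ ξ η : ℝ, 0 ≤ ξ → 0 ≤ η → ξ + η < 1 →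
      (1 - η) ^ (-(α + 1 / 2)) * ((1 - ξ) ^ (-(β + 1 / 2)) * (1 - ξ - η)⁻¹) ≤
        C * baileySum α β ξ η := by
  obtain ⟨C₁, hC₁, h₁⟩ := exists_baileySum_lower_aux hα hβ
  obtain ⟨C₂, hC₂, h₂⟩ := exists_baileySum_lower_aux hβ hα
  have half : ∀ a x : ℝ, 0 ≤ a → 1 / 2 ≤ x → x ^ (-a) ≤ 2 ^ a := by
    intro a x ha hx
    have := Real.rpow_le_rpow_of_nonpos (x := 1 / 2) (by norm_num) hx (neg_nonpos.2 ha)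
    rwa [one_div, Real.inv_rpow zero_le_two, Real.rpow_neg zero_le_two, inv_inv] at this
  refine ⟨2 ^ (α + 1 / 2) * C₁ + 2 ^ (β + 1 / 2) * C₂, by positivity, fun ξ η hξ hη hlt => ?_⟩
  have hS : 0 ≤ baileySum α β ξ η :=
    tsum_nonneg (baileyTerm_nonneg (by linarith) (by linarith) ξ η)
  have hA : 0 ≤ 2 ^ (α + 1 / 2) * C₁ * baileySum α β ξ η := by positivity
  have hB : 0 ≤ 2 ^ (β + 1 / 2) * C₂ * baileySum α β ξ η := by positivity
  have hd : 0 ≤ (1 - ξ - η)⁻¹ := inv_nonneg.2 (by linarith)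
  -- As ξ + η < 1, one variable is at most 1/2. The factor missing from the corresponding one-sided
  -- bound is then at most a power of 2.
  rcases le_total η (1 / 2) with hη2 | hη2
  · have h3 := half (α + 1 / 2) (1 - η) (by linarith) (by linarith)
    have h4 := h₁ ξ η hξ hη hlt
    have h5 := mul_le_mul h3 h4
      (mul_nonneg (Real.rpow_nonneg (by linarith) _) hd) (by positivity)
    linarith
  · have h3 := half (β + 1 / 2) (1 - ξ) (by linarith) (by linarith)
    have h4 := h₂ η ξ hη hξ (by linarith)
    rw [baileySum_swap, sub_right_comm] at h4
    have h5 := mul_le_mul h3 h4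
      (mul_nonneg (Real.rpow_nonneg (by linarith) _) hd) (by positivity)
    linarith

end

/-! ### The Jacobi operator and its polynomial eigenfunctions -/

section

open Finset Filter Topology
open Polynomial (X C)

/-- The Jacobi differential operator `s(1-s) p'' + (α+1-(α+β+2)s) p'`. -/
def jacobiOp (α β : ℝ) (p : Polynomial ℝ) : Polynomial ℝ :=
  X * (1 - X) * p.derivative.derivative + (C (α + 1) - C (α + β + 2) * X) * p.derivative

lemma jacobiOp_add (α β : ℝ) (p q : Polynomial ℝ) :
    jacobiOp α β (p + q) = jacobiOp α β p + jacobiOp α β q := by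
  simp only [jacobiOp, Polynomial.derivative_add]; ring

lemma jacobiOp_C_mul (α β r : ℝ) (p : Polynomial ℝ) :
    jacobiOp α β (C r * p) = C r * jacobiOp α β p := by
  simp only [jacobiOp, Polynomial.derivative_C_mul]; ring

lemma jacobiOp_sum {ι : Type*} (α β : ℝ) (t : Finset ι) (f : ι → Polynomial ℝ) :
    jacobiOp α β (∑ i ∈ t, f i) = ∑ i ∈ t, jacobiOp α β (f i) := by
  simp only [jacobiOp, Polynomial.derivative_sum, mul_sum, sum_add_distrib]

/-- These products treat both endpoints alike, and the operator lowers just one exponent by one at a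
time. The Rodrigues sum and Watson's sum are both written in them. -/
lemma jacobiOp_monomial (α β : ℝ) (m k : ℕ) :
    jacobiOp α β (X ^ m * (1 - X) ^ k) =
      C (m * (m + α)) * (X ^ (m - 1) * (1 - X) ^ k) +
        C (k * (k + β)) * (X ^ m * (1 - X) ^ (k - 1)) -
        C ((m + k) * (m + k + α + β + 1)) * (X ^ m * (1 - X) ^ k) := by
  have hX : ∀ j : ℕ, Polynomial.derivative ((X : Polynomial ℝ) ^ (j + 1)) =
      C ((j : ℝ) + 1) * X ^ j := by
    intro j; rw [Polynomial.derivative_X_pow]; simp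
  have hY : ∀ j : ℕ, Polynomial.derivative ((1 - X : Polynomial ℝ) ^ (j + 1)) =
      - (C ((j : ℝ) + 1) * (1 - X) ^ j) := by
    intro j; rw [Polynomial.derivative_pow]; simp
  have h2 : (C (2 : ℝ) : Polynomial ℝ) = 2 := rfl
  unfold jacobiOp
  -- Exponents 0 and 1 are separated because of the truncated subtraction and the second derivative.
  rcases m with _ | _ | m <;> rcases k with _ | _ | k <;>
  · simp only [Polynomial.derivative_mul, hX, hY, Polynomial.derivative_C, pow_zero,
      Polynomial.derivative_one, Polynomial.derivative_neg,
      Polynomial.derivative_sub, Polynomial.derivative_X, zero_add, pow_one,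
      Nat.add_sub_cancel, Nat.cast_add, Nat.cast_one, Nat.cast_zero, map_add, map_mul, map_one,
      map_zero, Nat.zero_sub, Nat.sub_self, h2]
    ring

lemma coeff_jacobiOp (α β : ℝ) (p : Polynomial ℝ) (j : ℕ) :
    (jacobiOp α β p).coeff j =
      (j + 1) * (j + 1 + α) * p.coeff (j + 1) - j * (j + α + β + 1) * p.coeff j := by
  have e : jacobiOp α β p = X * p.derivative.derivative - X * (X * p.derivative.derivative) +
      (C (α + 1) * p.derivative - C (α + β + 2) * (X * p.derivative)) := by
    unfold jacobiOp; ring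
  rw [e, Polynomial.coeff_add, Polynomial.coeff_sub, Polynomial.coeff_sub,
    Polynomial.coeff_C_mul, Polynomial.coeff_C_mul]
  rcases j with _ | _ | j
  · simp only [Polynomial.coeff_derivative, Polynomial.mul_coeff_zero, Polynomial.coeff_X_zero]
    push_cast; ring
  · simp [Polynomial.coeff_derivative, Polynomial.coeff_X_mul]; ring
  · simp [Polynomial.coeff_derivative, Polynomial.coeff_X_mul]; ring

/-- A polynomial eigenfunction vanishing at `0` is zero. -/
lemma eq_zero_of_jacobiOp {α β μ : ℝ} (hα : -1 < α) {p : Polynomial ℝ}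
    (h : jacobiOp α β p = C μ * p) (h0 : p.eval 0 = 0) : p = 0 := by
  ext j
  rw [Polynomial.coeff_zero]
  induction j with
  | zero => rwa [Polynomial.coeff_zero_eq_eval_zero]
  | succ j ih =>
    have h1 := congrArg (fun q => Polynomial.coeff q j) h
    simp only [coeff_jacobiOp, Polynomial.coeff_C_mul, ih, mul_zero, sub_zero] at h1
    -- Since α > -1, the leading factor of the two-term recursion never vanishes, so each
    -- coefficient is forced by the preceding one.
    have h2 : ((j : ℝ) + 1) * (j + 1 + α) ≠ 0 := by
      have : (0 : ℝ) ≤ j := Nat.cast_nonneg j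
      exact (mul_pos (by linarith) (by linarith)).ne'
    exact (mul_eq_zero.1 h1).resolve_left h2

/-- Polynomial eigenfunctions with the same eigenvalue are proportional. -/
lemma jacobiOp_proportional {α β μ : ℝ} (hα : -1 < α) {p q : Polynomial ℝ}
    (hp : jacobiOp α β p = C μ * p) (hq : jacobiOp α β q = C μ * q) (s : ℝ) :
    q.eval 0 * p.eval s = p.eval 0 * q.eval s := by
  have h : C (q.eval 0) * p + C (-p.eval 0) * q = 0 := by
    refine eq_zero_of_jacobiOp hα (β := β) (μ := μ) ?_ ?_
    · rw [jacobiOp_add, jacobiOp_C_mul, jacobiOp_C_mul, hp, hq]; ring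
    · simp; ring
  have := congrArg (Polynomial.eval s) h
  simp at this
  linarith

/-- The Jacobi polynomial in the variable `s = (1-x)/2`. -/
def shiftedJacobi (α β : ℝ) (n : ℕ) : Polynomial ℝ :=
  ∑ k ∈ range (n + 1),
    C (((descPochhammer ℝ (n - k)).eval (α + n) / ((n - k).factorial : ℝ)) *
      ((descPochhammer ℝ k).eval (β + n) / (k.factorial : ℝ)) * (-1) ^ k) *
      (X ^ k * (1 - X) ^ (n - k))

lemma eval_jacobiPoly (α β : ℝ) (n : ℕ) (x : ℝ) :
    (jacobiPoly α β n).eval x = (shiftedJacobi α β n).eval ((1 - x) / 2) := by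
  simp only [jacobiPoly, shiftedJacobi, Polynomial.eval_finsetSum]
  refine sum_congr rfl fun k _ => ?_
  simp only [Polynomial.eval_mul, Polynomial.eval_pow, Polynomial.eval_C, Polynomial.eval_sub,
    Polynomial.eval_add, Polynomial.eval_X, Polynomial.eval_one]
  have h1 : (1 : ℝ) / 2 * (x - 1) = (-1) * ((1 - x) / 2) := by ring
  have h2 : (1 : ℝ) / 2 * (x + 1) = 1 - (1 - x) / 2 := by ring
  rw [h1, h2, mul_pow]
  ring

lemma descPochhammer_div_succ (r : ℝ) (k : ℕ) :
    ((descPochhammer ℝ (k + 1)).eval r / ((k + 1).factorial : ℝ)) * (k + 1) =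
      (descPochhammer ℝ k).eval r / (k.factorial : ℝ) * (r - k) := by
  have : (k.factorial : ℝ) ≠ 0 := by exact_mod_cast k.factorial_ne_zero
  have h2 : (k : ℝ) + 1 ≠ 0 := by positivity
  rw [descPochhammer_succ_eval, Nat.factorial_succ]
  push_cast
  field_simp

lemma descPochhammer_eval_add (α : ℝ) (n : ℕ) :
    (descPochhammer ℝ n).eval (α + n) = poch (α + 1) n := by
  rw [descPochhammer_eval_eq_prod_range, poch, ← prod_range_reflect]
  refine prod_congr rfl fun i hi => ?_
  have : i + 1 ≤ n := by simpa using hi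
  obtain ⟨k, rfl⟩ := Nat.exists_eq_add_of_le this
  have h : i + 1 + k - 1 - i = k := by omega
  rw [h]; push_cast; ring

lemma shiftedJacobi_eval_zero (α β : ℝ) (n : ℕ) :
    (shiftedJacobi α β n).eval 0 = poch (α + 1) n / n.factorial := by
  rw [shiftedJacobi, Polynomial.eval_finsetSum, sum_eq_single 0]
  · simp [descPochhammer_eval_add]
  · intro k _ hk; simp [hk]
  · simp

lemma shiftedJacobi_eval_one (α β : ℝ) (n : ℕ) :
    (shiftedJacobi α β n).eval 1 = (-1) ^ n * (poch (β + 1) n / n.factorial) := by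
  rw [shiftedJacobi, Polynomial.eval_finsetSum, sum_eq_single n]
  · simp [descPochhammer_eval_add]; ring
  · intro k hk hkn
    have : n - k ≠ 0 := by have := mem_range.1 hk; omega
    simp [this]
  · simp

lemma jacobiOp_shiftedJacobi (α β : ℝ) (n : ℕ) :
    jacobiOp α β (shiftedJacobi α β n) = C (-(n * (n + α + β + 1))) * shiftedJacobi α β n := by
  set A : ℕ → ℝ := fun k => (descPochhammer ℝ k).eval (α + n) / (k.factorial : ℝ) with hA
  set B : ℕ → ℝ := fun k => (descPochhammer ℝ k).eval (β + n) / (k.factorial : ℝ) with hB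
  have hq : shiftedJacobi α β n = ∑ k ∈ range (n + 1),
      C (A (n - k) * B k * (-1) ^ k) * (X ^ k * (1 - X) ^ (n - k)) := rfl
  have hterm : ∀ k ∈ range (n + 1),
      jacobiOp α β (C (A (n - k) * B k * (-1) ^ k) * (X ^ k * (1 - X) ^ (n - k))) =
      C (-(n * (n + α + β + 1))) * (C (A (n - k) * B k * (-1) ^ k) * (X ^ k * (1 - X) ^ (n - k))) +
      (C (A (n - k) * B k * (-1) ^ k * (k * (k + α))) * (X ^ (k - 1) * (1 - X) ^ (n - k)) +
       C (A (n - k) * B k * (-1) ^ k * ((n - k : ℕ) * ((n - k : ℕ) + β))) *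
        (X ^ k * (1 - X) ^ (n - k - 1))) := by
    intro k hk
    have hkn : k ≤ n := by have := mem_range.1 hk; omega
    have e : (k : ℝ) + (n - k : ℕ) = n := by rw [← Nat.cast_add, Nat.add_sub_cancel' hkn]
    rw [jacobiOp_C_mul, jacobiOp_monomial, e]
    simp only [map_mul, map_neg]
    ring
  rw [hq, jacobiOp_sum, sum_congr rfl hterm, sum_add_distrib, ← mul_sum, sum_add_distrib]
  -- The two lowering sums cancel after an index shift: term k + 1 of the first and term k of the
  -- second are multiples of the same s^k (1-s)^(n-k-1). The unmatched end terms carry a zero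
  -- factor.
  rw [add_eq_left, sum_range_succ', sum_range_succ _ n]
  simp only [Nat.cast_zero, zero_mul, mul_zero, map_zero, add_zero, Nat.sub_self]
  rw [← sum_add_distrib]
  refine sum_eq_zero fun k hk => ?_
  have hkn : k < n := mem_range.1 hk
  obtain ⟨j, rfl⟩ := Nat.exists_eq_add_of_lt hkn
  have e1 : k + j + 1 - (k + 1) = j := by omega
  have e2 : k + j + 1 - k = j + 1 := by omega
  rw [e1, e2, Nat.add_sub_cancel, Nat.add_sub_cancel, ← add_mul, ← map_add]
  have hA' := descPochhammer_div_succ (α + (k + j + 1 : ℕ)) j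
  have hB' := descPochhammer_div_succ (β + (k + j + 1 : ℕ)) k
  have : A j * B (k + 1) * (-1) ^ (k + 1) * (((k + 1 : ℕ) : ℝ) * ((k + 1 : ℕ) + α)) +
      A (j + 1) * B k * (-1) ^ k * (((j + 1 : ℕ) : ℝ) * ((j + 1 : ℕ) + β)) = 0 := by
    simp only [hA, hB] at *
    push_cast at *
    rw [pow_succ]
    linear_combination (-((Polynomial.eval (α + ((k : ℝ) + j + 1)) (descPochhammer ℝ j)) /
      (j.factorial : ℝ)) * (-1) ^ k * (k + 1 + α)) * hB' +
      ((Polynomial.eval (β + ((k : ℝ) + j + 1)) (descPochhammer ℝ k)) /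
      (k.factorial : ℝ) * (-1) ^ k * (j + 1 + β)) * hA'
  rw [this]
  simp

/-! ### Watson's product formula -/

/-- The homogeneous part of degree `N` of `∑ x^m y^k / (m! (α+1)_m k! (β+1)_k)`. -/
def bilevel (α β x y : ℝ) (N : ℕ) : ℝ :=
  ∑ p ∈ antidiagonal N, jw α p.1 * jw β p.2 * (x ^ p.1 * y ^ p.2)

/-- `bilevel α β (sσ) ((1-s)(1-σ)) N` as a polynomial in `s`. -/
def levelPoly (α β σ : ℝ) (N : ℕ) : Polynomial ℝ :=
  ∑ p ∈ antidiagonal N, C (jw α p.1 * jw β p.2 * (σ ^ p.1 * (1 - σ) ^ p.2)) *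
    (X ^ p.1 * (1 - X) ^ p.2)

lemma eval_levelPoly (α β σ s : ℝ) (N : ℕ) :
    (levelPoly α β σ N).eval s = bilevel α β (s * σ) ((1 - s) * (1 - σ)) N := by
  simp only [levelPoly, bilevel, Polynomial.eval_finsetSum]
  refine sum_congr rfl fun p _ => ?_
  simp [mul_pow]
  ring

lemma jw_succ {α : ℝ} (hα : -1 < α) (m : ℕ) :
    jw α (m + 1) * (((m + 1 : ℕ) : ℝ) * ((m + 1 : ℕ) + α)) = jw α m := by
  have hp : poch (α + 1) m ≠ 0 := (poch_pos (by linarith) m).ne'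
  have hf : (m.factorial : ℝ) ≠ 0 := by exact_mod_cast m.factorial_ne_zero
  have h1 : (m : ℝ) + 1 ≠ 0 := by positivity
  have h2 : α + 1 + m ≠ 0 := by
    have : (0 : ℝ) ≤ m := Nat.cast_nonneg m
    linarith
  rw [jw, jw, poch_succ, Nat.factorial_succ]
  push_cast
  field_simp
  ring

/-- The weights `jw` absorb m(m+α) and k(k+β). Lowering the power of s leaves a factor σ, lowering
that of 1 - s leaves 1 - σ, and these add to 1, so exactly one copy of the lower level survives. -/
lemma jacobiOp_levelPoly {α β : ℝ} (hα : -1 < α) (hβ : -1 < β) (σ : ℝ) (N : ℕ) :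
    jacobiOp α β (levelPoly α β σ (N + 1)) = levelPoly α β σ N -
      C (((N + 1 : ℕ) : ℝ) * ((N + 1 : ℕ) + α + β + 1)) * levelPoly α β σ (N + 1) := by
  have hterm : ∀ p ∈ antidiagonal (N + 1),
      jacobiOp α β (C (jw α p.1 * jw β p.2 * (σ ^ p.1 * (1 - σ) ^ p.2)) *
        (X ^ p.1 * (1 - X) ^ p.2)) =
      (C (jw α p.1 * jw β p.2 * (σ ^ p.1 * (1 - σ) ^ p.2) * (p.1 * (p.1 + α))) *
        (X ^ (p.1 - 1) * (1 - X) ^ p.2) +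
      C (jw α p.1 * jw β p.2 * (σ ^ p.1 * (1 - σ) ^ p.2) * (p.2 * (p.2 + β))) *
        (X ^ p.1 * (1 - X) ^ (p.2 - 1))) -
      C (((N + 1 : ℕ) : ℝ) * ((N + 1 : ℕ) + α + β + 1)) *
        (C (jw α p.1 * jw β p.2 * (σ ^ p.1 * (1 - σ) ^ p.2)) * (X ^ p.1 * (1 - X) ^ p.2)) := by
    intro p hp
    rw [jacobiOp_C_mul, jacobiOp_monomial, ← mem_antidiagonal.1 hp]
    simp only [map_mul, Nat.cast_add]
    ring
  have h1 : ∑ p ∈ antidiagonal (N + 1),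
      C (jw α p.1 * jw β p.2 * (σ ^ p.1 * (1 - σ) ^ p.2) * (p.1 * (p.1 + α))) *
        (X ^ (p.1 - 1) * (1 - X) ^ p.2) = C σ * levelPoly α β σ N := by
    rw [Finset.Nat.sum_antidiagonal_succ, levelPoly, mul_sum]
    simp only [Nat.cast_zero, zero_mul, mul_zero, map_zero, zero_add]
    refine sum_congr rfl fun p _ => ?_
    rw [← jw_succ hα p.1, pow_succ, Nat.add_sub_cancel, ← mul_assoc (C σ), ← map_mul]
    congr 2
    ring
  have h2 : ∑ p ∈ antidiagonal (N + 1),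
      C (jw α p.1 * jw β p.2 * (σ ^ p.1 * (1 - σ) ^ p.2) * (p.2 * (p.2 + β))) *
        (X ^ p.1 * (1 - X) ^ (p.2 - 1)) = C (1 - σ) * levelPoly α β σ N := by
    rw [Finset.Nat.sum_antidiagonal_succ', levelPoly, mul_sum]
    simp only [Nat.cast_zero, zero_mul, mul_zero, map_zero, zero_add]
    refine sum_congr rfl fun p _ => ?_
    rw [← jw_succ hβ p.2, pow_succ, Nat.add_sub_cancel, ← mul_assoc (C (1 - σ)), ← map_mul]
    congr 2
    ring
  have e : levelPoly α β σ (N + 1) = ∑ p ∈ antidiagonal (N + 1),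
    C (jw α p.1 * jw β p.2 * (σ ^ p.1 * (1 - σ) ^ p.2)) * (X ^ p.1 * (1 - X) ^ p.2) := rfl
  rw [e, jacobiOp_sum, sum_congr rfl hterm, sum_sub_distrib, sum_add_distrib, h1, h2, ← mul_sum,
    ← add_mul, ← map_add]
  simp

lemma jacobiOp_levelPoly_zero (α β σ : ℝ) : jacobiOp α β (levelPoly α β σ 0) = 0 := by
  simp [levelPoly, jacobiOp]

/-- The finite double hypergeometric sum representing a product of Jacobi polynomials. -/
def productPoly (α β σ : ℝ) (n : ℕ) : Polynomial ℝ :=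
  ∑ N ∈ range (n + 1), C (poch (-n) N * poch (n + α + β + 1) N) * levelPoly α β σ N

lemma jacobiOp_productPoly {α β : ℝ} (hα : -1 < α) (hβ : -1 < β) (σ : ℝ) (n : ℕ) :
    jacobiOp α β (productPoly α β σ n) =
      C (-(n * (n + α + β + 1))) * productPoly α β σ n := by
  set L := levelPoly α β σ
  set a : ℕ → ℝ := fun N => poch (-n) N * poch (n + α + β + 1) N with ha
  have hQ : productPoly α β σ n = ∑ N ∈ range (n + 1), C (a N) * L N := rfl
  have hop : jacobiOp α β (productPoly α β σ n) = (∑ N ∈ range n, C (a (N + 1)) * L N) -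
      ∑ N ∈ range (n + 1), C (a N * (N * (N + α + β + 1))) * L N := by
    rw [hQ, jacobiOp_sum, sum_range_succ', sum_range_succ' (fun N => C (a N * _) * L N),
      jacobiOp_C_mul, jacobiOp_levelPoly_zero]
    simp only [Nat.cast_zero, zero_mul, mul_zero, map_zero, add_zero]
    rw [← sum_sub_distrib]
    refine sum_congr rfl fun N _ => ?_
    rw [jacobiOp_C_mul, jacobiOp_levelPoly hα hβ]
    simp only [map_mul]
    ring
  -- This is the factorization (N-n)(N+n+α+β+1) = N(N+α+β+1) - n(n+α+β+1). At the top level N = n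
  -- the eigenvalue is already the right one, so no further level is needed.
  have hrec : ∀ N, a (N + 1) = a N * (N * (N + α + β + 1)) - a N * (n * (n + α + β + 1)) := by
    intro N
    simp only [ha, poch_succ]
    ring
  rw [hop, hQ, mul_sum, sum_range_succ, sum_range_succ (fun N => C (-_) * _), ← sub_sub,
    ← sum_sub_distrib]
  have : ∀ N ∈ range n, C (a (N + 1)) * L N - C (a N * (N * (N + α + β + 1))) * L N =
      C (-(n * (n + α + β + 1))) * (C (a N) * L N) := by
    intro N _
    rw [hrec N]
    simp only [map_sub, map_mul, map_neg]
    ring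
  rw [sum_congr rfl this]
  simp only [map_mul, map_neg]
  ring

lemma eval_productPoly (α β σ s : ℝ) (n : ℕ) :
    (productPoly α β σ n).eval s = ∑ N ∈ range (n + 1),
      poch (-n) N * poch (n + α + β + 1) N * bilevel α β (s * σ) ((1 - s) * (1 - σ)) N := by
  simp only [productPoly, Polynomial.eval_finsetSum, Polynomial.eval_mul, Polynomial.eval_C,
    eval_levelPoly]

lemma eval_productPoly_comm (α β σ s : ℝ) (n : ℕ) :
    (productPoly α β σ n).eval s = (productPoly α β s n).eval σ := by
  rw [eval_productPoly, eval_productPoly, mul_comm s, mul_comm (1 - s)]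

lemma bilevel_zero_zero (α β : ℝ) (N : ℕ) : bilevel α β 0 0 N = if N = 0 then 1 else 0 := by
  rcases N with _ | N
  · simp [bilevel, jw]
  · rw [if_neg (Nat.succ_ne_zero N), bilevel]
    refine sum_eq_zero fun p hp => ?_
    have h := mem_antidiagonal.1 hp
    rcases Nat.eq_zero_or_pos p.1 with h1 | h1
    · have : p.2 ≠ 0 := by omega
      simp [this]
    · simp [h1.ne']

lemma eval_productPoly_zero_one (α β : ℝ) (n : ℕ) : (productPoly α β 0 n).eval 1 = 1 := by
  rw [eval_productPoly]
  simp [bilevel_zero_zero]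

/-- Watson's formula for the product of two Jacobi polynomials of the same degree. -/
lemma shiftedJacobi_mul {α β : ℝ} (hα : -1 < α) (hβ : -1 < β) (n : ℕ) (s σ : ℝ) :
    (shiftedJacobi α β n).eval s * (shiftedJacobi α β n).eval σ =
      (shiftedJacobi α β n).eval 0 * (shiftedJacobi α β n).eval 1 *
        (productPoly α β σ n).eval s := by
  have hq := jacobiOp_shiftedJacobi α β n
  have h0 : (shiftedJacobi α β n).eval 0 ≠ 0 := by
    rw [shiftedJacobi_eval_zero]
    exact (div_pos (poch_pos (by linarith) n) (by exact_mod_cast n.factorial_pos)).ne'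
  have key : ∀ s σ : ℝ, (shiftedJacobi α β n).eval 0 * (productPoly α β σ n).eval s =
      (productPoly α β σ n).eval 0 * (shiftedJacobi α β n).eval s := fun s σ =>
    jacobiOp_proportional hα (jacobiOp_productPoly hα hβ σ n) hq s
  -- Write Q for the double sum. It is symmetric and an eigenfunction in s, so two uses of
  -- proportionality give q(0)² Q(s,σ) = Q(0,0) q(s) q(σ). The constant is fixed at s = 1, σ = 0,
  -- where both sσ and (1-s)(1-σ) vanish and Q = 1.
  have k1 := key s σ
  have k2 := key σ 0
  have k3 := key 1 0
  rw [eval_productPoly_zero_one] at k3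
  rw [eval_productPoly_comm α β σ 0] at k1
  set q := shiftedJacobi α β n
  set Q0 := (productPoly α β 0 n).eval 0
  have k4 : q.eval 0 * (q.eval 0 * (productPoly α β σ n).eval s) =
      Q0 * q.eval s * q.eval σ := by rw [k1]; linear_combination (q.eval s) * k2
  have : q.eval 0 * (q.eval s * q.eval σ) =
      q.eval 0 * (q.eval 0 * q.eval 1 * (productPoly α β σ n).eval s) := by
    linear_combination (-q.eval 1) * k4 + (q.eval s * q.eval σ) * k3
  exact mul_left_cancel₀ h0 this

end

/-! ### Derivatives, integration by parts and norms -/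

section

open Finset Filter Topology MeasureTheory
open Polynomial (X C)

lemma jacobiOp_derivative (α β : ℝ) (p : Polynomial ℝ) :
    jacobiOp (α + 1) (β + 1) p.derivative =
      (jacobiOp α β p).derivative + C (α + β + 2) * p.derivative := by
  simp only [jacobiOp, Polynomial.derivative_add, Polynomial.derivative_mul,
    Polynomial.derivative_sub, Polynomial.derivative_X, Polynomial.derivative_one,
    Polynomial.derivative_C]
  have h2 : (C (2 : ℝ) : Polynomial ℝ) = 2 := rfl
  simp only [map_add, map_one, h2]
  ring

/-- By `jacobiOp_derivative` both sides are eigenfunctions for (α+1, β+1) with the same eigenvalue,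
so it suffices to compare them at 0. There the derivative is read off from the constant coefficient
of the eigenvalue equation. -/
lemma derivative_shiftedJacobi {α : ℝ} (hα : -1 < α) (β : ℝ) (n : ℕ) :
    (shiftedJacobi α β (n + 1)).derivative =
      C (-(n + α + β + 2)) * shiftedJacobi (α + 1) (β + 1) n := by
  have hq := jacobiOp_shiftedJacobi α β (n + 1)
  have hr := jacobiOp_shiftedJacobi (α + 1) (β + 1) n
  have h0 := shiftedJacobi_eval_zero α β (n + 1)
  have h0' := shiftedJacobi_eval_zero (α + 1) (β + 1) n
  set q := shiftedJacobi α β (n + 1)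
  set r := shiftedJacobi (α + 1) (β + 1) n
  have h1 : q.derivative.eval 0 = -(n + α + β + 2) * r.eval 0 := by
    have hc := congrArg (fun p => Polynomial.coeff p 0) hq
    simp only [coeff_jacobiOp, Polynomial.coeff_C_mul] at hc
    rw [Polynomial.coeff_zero_eq_eval_zero, h0, poch_succ', Nat.factorial_succ] at hc
    rw [← Polynomial.coeff_zero_eq_eval_zero, Polynomial.coeff_derivative, h0']
    have hf : (n.factorial : ℝ) ≠ 0 := by exact_mod_cast n.factorial_ne_zero
    have hn : (n : ℝ) + 1 ≠ 0 := by positivity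
    have ha : α + 1 ≠ 0 := by linarith
    push_cast at hc
    field_simp at hc
    have h2 : q.coeff 1 * n.factorial = -(n + α + β + 2) * poch (α + 1 + 1) n := by
      apply mul_left_cancel₀ (mul_ne_zero ha hn)
      linear_combination hc
    rw [← mul_div_assoc, ← h2]
    field_simp
    push_cast
    ring
  have h : q.derivative + C (n + α + β + 2) * r = 0 := by
    refine eq_zero_of_jacobiOp (α := α + 1) (β := β + 1)
      (μ := -(n * (n + (α + 1) + (β + 1) + 1))) (by linarith) ?_ ?_
    · rw [jacobiOp_add, jacobiOp_C_mul, hr, jacobiOp_derivative, hq, Polynomial.derivative_C_mul]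
      have h2 : (C (2 : ℝ) : Polynomial ℝ) = 2 := rfl
      simp only [map_neg, map_mul, map_add, map_one, Nat.cast_add, Nat.cast_one, h2]
      ring
    · rw [Polynomial.eval_add, h1, Polynomial.eval_mul, Polynomial.eval_C]; ring
  rw [eq_neg_of_add_eq_zero_left h, map_neg, neg_mul]

/-- The Jacobi weight on `[0,1]`. -/
def jacobiWeight (α β s : ℝ) : ℝ := s ^ α * (1 - s) ^ β

lemma ofReal_jacobiWeight {α β s : ℝ} (hs : s ∈ Set.Icc (0 : ℝ) 1) :
    ((jacobiWeight α β s : ℝ) : ℂ) =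
      (s : ℂ) ^ (((α + 1 : ℝ) : ℂ) - 1) * (1 - (s : ℂ)) ^ (((β + 1 : ℝ) : ℂ) - 1) := by
  rw [jacobiWeight, Complex.ofReal_mul, Complex.ofReal_cpow hs.1,
    Complex.ofReal_cpow (by linarith [hs.2])]
  push_cast
  ring_nf

lemma intervalIntegrable_jacobiWeight {α β : ℝ} (hα : -1 < α) (hβ : -1 < β) :
    IntervalIntegrable (jacobiWeight α β) volume 0 1 := by
  have h := Complex.betaIntegral_convergent (u := ((α + 1 : ℝ) : ℂ)) (v := ((β + 1 : ℝ) : ℂ))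
    (by rw [Complex.ofReal_re]; linarith) (by rw [Complex.ofReal_re]; linarith)
  refine h.norm.congr ?_
  intro s hs
  rw [Set.uIoc_of_le zero_le_one] at hs
  have hs' : s ∈ Set.Icc (0 : ℝ) 1 := ⟨hs.1.le, hs.2⟩
  simp only
  rw [← ofReal_jacobiWeight hs', Complex.norm_real, Real.norm_of_nonneg]
  exact mul_nonneg (Real.rpow_nonneg hs'.1 _) (Real.rpow_nonneg (by linarith [hs.2]) _)

lemma integral_jacobiWeight {α β : ℝ} (hα : -1 < α) (hβ : -1 < β) :
    ∫ s in (0 : ℝ)..1, jacobiWeight α β s = ProbabilityTheory.beta (α + 1) (β + 1) := by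
  rw [ProbabilityTheory.beta_eq_betaIntegralReal _ _ (by linarith) (by linarith),
    Complex.betaIntegral]
  have h : ∫ s in (0 : ℝ)..1, ((s : ℂ) ^ (((α + 1 : ℝ) : ℂ) - 1) *
      (1 - (s : ℂ)) ^ (((β + 1 : ℝ) : ℂ) - 1)) =
      ∫ s in (0 : ℝ)..1, ((jacobiWeight α β s : ℝ) : ℂ) := by
    refine intervalIntegral.integral_congr fun s hs => ?_
    rw [Set.uIcc_of_le zero_le_one] at hs
    exact (ofReal_jacobiWeight hs).symm
  rw [h, intervalIntegral.integral_ofReal, Complex.ofReal_re]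

lemma Gamma_add_natCast {x : ℝ} (hx : 0 < x) (n : ℕ) :
    Real.Gamma (x + n) = poch x n * Real.Gamma x := by
  induction n with
  | zero => simp
  | succ n ih =>
    have : x + (n : ℝ) ≠ 0 := by positivity
    rw [Nat.cast_succ, ← add_assoc, Real.Gamma_add_one this, ih, poch_succ]
    ring

lemma beta_add_natCast {x y : ℝ} (hx : 0 < x) (hy : 0 < y) (n : ℕ) :
    ProbabilityTheory.beta (x + n) (y + n) =
      poch x n * poch y n / poch (x + y) (2 * n) * ProbabilityTheory.beta x y := by
  have h : x + n + (y + n) = x + y + (2 * n : ℕ) := by push_cast; ring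
  rw [ProbabilityTheory.beta, ProbabilityTheory.beta, h, Gamma_add_natCast hx,
    Gamma_add_natCast hy, Gamma_add_natCast (add_pos hx hy)]
  rw [div_mul_div_comm]
  ring

/-- The squared norm of the shifted Jacobi polynomial. -/
def shiftedNormSq (α β : ℝ) (n : ℕ) : ℝ :=
  ∫ s in (0 : ℝ)..1, ((shiftedJacobi α β n).eval s) ^ 2 * jacobiWeight α β s

lemma hasDerivAt_jacobiWeight (α β : ℝ) {s : ℝ} (hs : s ∈ Set.Ioo (0 : ℝ) 1) :
    HasDerivAt (jacobiWeight (α + 1) (β + 1))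
      (jacobiWeight α β s * ((α + 1) - (α + β + 2) * s)) s := by
  have h1 : 0 < s := hs.1
  have h2 : 0 < 1 - s := by linarith [hs.2]
  have d1 := Real.hasDerivAt_rpow_const (x := s) (p := α + 1) (Or.inl h1.ne')
  have d2 := ((hasDerivAt_id s).const_sub 1).rpow_const (p := β + 1) (Or.inl h2.ne')
  have d := d1.mul d2
  refine d.congr_deriv ?_
  simp only [id, jacobiWeight]
  rw [add_sub_cancel_right, add_sub_cancel_right, Real.rpow_add_one h1.ne',
    Real.rpow_add_one h2.ne']
  ring

lemma continuous_jacobiWeight {α β : ℝ} (hα : 0 ≤ α) (hβ : 0 ≤ β) :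
    Continuous (jacobiWeight α β) :=
  (Real.continuous_rpow_const hα).mul
    ((Real.continuous_rpow_const hβ).comp (continuous_const.sub continuous_id))

lemma jacobiWeight_succ {α β s : ℝ} (hs : s ∈ Set.Ioo (0 : ℝ) 1) :
    jacobiWeight (α + 1) (β + 1) s = jacobiWeight α β s * (s * (1 - s)) := by
  have h2 : 0 < 1 - s := by linarith [hs.2]
  rw [jacobiWeight, jacobiWeight, Real.rpow_add_one hs.1.ne', Real.rpow_add_one h2.ne']
  ring

/-- Integration by parts for the Jacobi operator. -/
lemma integral_jacobiOp_mul {α β : ℝ} (hα : -1 < α) (hβ : -1 < β) (p : Polynomial ℝ) :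
    ∫ s in (0 : ℝ)..1, (jacobiOp α β p).eval s * p.eval s * jacobiWeight α β s =
      -∫ s in (0 : ℝ)..1, (p.derivative.eval s) ^ 2 * jacobiWeight (α + 1) (β + 1) s := by
  have hw := intervalIntegrable_jacobiWeight hα hβ
  have hw' := intervalIntegrable_jacobiWeight (α := α + 1) (β := β + 1) (by linarith) (by linarith)
  have i1 : IntervalIntegrable
      (fun s => (jacobiOp α β p).eval s * p.eval s * jacobiWeight α β s) volume 0 1 :=
    hw.continuousOn_mul ((Polynomial.continuous _).mul (Polynomial.continuous _)).continuousOn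
  have i2 : IntervalIntegrable
      (fun s => (p.derivative.eval s) ^ 2 * jacobiWeight (α + 1) (β + 1) s) volume 0 1 :=
    hw'.continuousOn_mul ((Polynomial.continuous _).pow 2).continuousOn
  -- Self-adjoint form: the operator applied to p, times the weight, is the derivative of the raised
  -- weight times p'. Since α + 1 and β + 1 are positive, the boundary terms vanish.
  have hF := intervalIntegral.integral_eq_sub_of_hasDerivAt_of_le (a := 0) (b := 1)
    (f := fun s => jacobiWeight (α + 1) (β + 1) s * (p.derivative.eval s * p.eval s))
    (f' := fun s => (jacobiOp α β p).eval s * p.eval s * jacobiWeight α β s +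
      (p.derivative.eval s) ^ 2 * jacobiWeight (α + 1) (β + 1) s) zero_le_one
    ((continuous_jacobiWeight (by linarith) (by linarith)).mul
      ((Polynomial.continuous _).mul (Polynomial.continuous _))).continuousOn ?_ (i1.add i2)
  · rw [intervalIntegral.integral_add i1 i2] at hF
    have e0 : jacobiWeight (α + 1) (β + 1) 0 = 0 := by
      rw [jacobiWeight, Real.zero_rpow (by linarith), zero_mul]
    have e1 : jacobiWeight (α + 1) (β + 1) 1 = 0 := by
      rw [jacobiWeight, sub_self, Real.zero_rpow (by linarith), mul_zero]
    rw [e0, e1] at hF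
    linarith
  · intro s hs
    have d := (hasDerivAt_jacobiWeight α β hs).mul
      ((p.derivative.hasDerivAt s).mul (p.hasDerivAt s))
    refine d.congr_deriv ?_
    rw [jacobiWeight_succ hs]
    simp only [jacobiOp, Pi.mul_apply, Polynomial.eval_add, Polynomial.eval_mul, Polynomial.eval_sub,
      Polynomial.eval_X, Polynomial.eval_C, Polynomial.eval_one]
    ring

/-- The eigenvalue equation and integration by parts express (n+1)(n+α+β+2) ‖q_{n+1}‖² as the
squared norm of the derivative, which is a multiple of the degree n polynomial for (α+1, β+1). -/
lemma shiftedNormSq_succ {α β : ℝ} (hα : -(1 / 2) ≤ α) (hβ : -(1 / 2) ≤ β) (n : ℕ) :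
    (n + 1) * shiftedNormSq α β (n + 1) =
      (n + α + β + 2) * shiftedNormSq (α + 1) (β + 1) n := by
  have h := integral_jacobiOp_mul (α := α) (β := β) (by linarith) (by linarith)
    (shiftedJacobi α β (n + 1))
  rw [jacobiOp_shiftedJacobi, derivative_shiftedJacobi (by linarith)] at h
  have e1 : ∀ s, (C (-(((n + 1 : ℕ) : ℝ) * ((n + 1 : ℕ) + α + β + 1))) *
      shiftedJacobi α β (n + 1)).eval s * (shiftedJacobi α β (n + 1)).eval s *
      jacobiWeight α β s = -(((n : ℝ) + 1) * (n + α + β + 2)) *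
      (((shiftedJacobi α β (n + 1)).eval s) ^ 2 * jacobiWeight α β s) := by
    intro s
    simp only [Polynomial.eval_mul, Polynomial.eval_C]
    push_cast
    ring
  have e2 : ∀ s, ((C (-((n : ℝ) + α + β + 2)) * shiftedJacobi (α + 1) (β + 1) n).eval s) ^ 2 *
      jacobiWeight (α + 1) (β + 1) s = (n + α + β + 2) ^ 2 *
      (((shiftedJacobi (α + 1) (β + 1) n).eval s) ^ 2 * jacobiWeight (α + 1) (β + 1) s) := by
    intro s
    simp only [Polynomial.eval_mul, Polynomial.eval_C]
    ring
  simp only [e1, e2] at h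
  rw [intervalIntegral.integral_const_mul, intervalIntegral.integral_const_mul] at h
  have hn : (0 : ℝ) ≤ n := Nat.cast_nonneg n
  have hc : (n : ℝ) + α + β + 2 ≠ 0 := by linarith
  apply mul_left_cancel₀ hc
  unfold shiftedNormSq
  linear_combination -h

/-- Each step of the induction raises both parameters by one, hence they are quantified inside. The
descent ends at a Beta integral. -/
lemma shiftedNormSq_eq_aux (n : ℕ) : ∀ {α β : ℝ}, -(1 / 2) ≤ α → -(1 / 2) ≤ β →
    shiftedNormSq α β n = rbin (n + α + β + 1) n *
      ProbabilityTheory.beta (α + 1 + n) (β + 1 + n) := by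
  induction n with
  | zero =>
    intro α β hα hβ
    rw [← add_zero (α + 1), ← add_zero (β + 1)]
    have h : ∀ s, (shiftedJacobi α β 0).eval s = 1 := fun s => by simp [shiftedJacobi]
    simp only [shiftedNormSq, h, one_pow, one_mul]
    rw [integral_jacobiWeight (by linarith) (by linarith)]
    simp [rbin]
  | succ n ih =>
    intro α β hα hβ
    have h := shiftedNormSq_succ hα hβ n
    rw [ih (by linarith) (by linarith)] at h
    have hf : (n.factorial : ℝ) ≠ 0 := by exact_mod_cast n.factorial_ne_zero
    have hn : (n : ℝ) + 1 ≠ 0 := by positivity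
    apply mul_left_cancel₀ hn
    rw [h, rbin, rbin, poch_succ', Nat.factorial_succ]
    push_cast
    rw [show (n : ℝ) + (α + 1) + (β + 1) + 1 = n + 1 + α + β + 1 + 1 by ring,
      show α + 1 + 1 + (n : ℝ) = α + 1 + (n + 1) by ring,
      show β + 1 + 1 + (n : ℝ) = β + 1 + (n + 1) by ring]
    field_simp
    ring

/-- The squared norms of the Jacobi polynomials. -/
lemma shiftedNormSq_eq {α β : ℝ} (hα : -(1 / 2) ≤ α) (hβ : -(1 / 2) ≤ β) (n : ℕ) :
    shiftedNormSq α β n = rbin (n + α + β + 1) n *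
      (poch (α + 1) n * poch (β + 1) n / poch (α + β + 2) (2 * n)) *
        ProbabilityTheory.beta (α + 1) (β + 1) := by
  rw [shiftedNormSq_eq_aux n hα hβ, beta_add_natCast (by linarith) (by linarith),
    show α + 1 + (β + 1) = α + β + 2 by ring]
  ring

lemma rbin_self_pos {α β : ℝ} (hα : -(1 / 2) ≤ α) (hβ : -(1 / 2) ≤ β) (n : ℕ) :
    0 < rbin (n + α + β + 1) n := by
  -- For n = 0 the parameter α + β + 1 may be zero, and positivity comes from the empty product.
  rcases n with _ | n
  · simp [rbin]
  · have : (0 : ℝ) ≤ n := Nat.cast_nonneg n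
    exact rbin_pos (by push_cast; linarith) _

lemma shiftedNormSq_pos {α β : ℝ} (hα : -(1 / 2) ≤ α) (hβ : -(1 / 2) ≤ β) (n : ℕ) :
    0 < shiftedNormSq α β n := by
  rw [shiftedNormSq_eq hα hβ]
  have h1 := rbin_self_pos hα hβ n
  have h2 := poch_pos (x := α + 1) (by linarith) n
  have h3 := poch_pos (x := β + 1) (by linarith) n
  have h4 := poch_pos (x := α + β + 2) (by linarith) (2 * n)
  have h5 := ProbabilityTheory.beta_pos (α := α + 1) (β := β + 1) (by linarith) (by linarith)
  positivity

lemma jacobiNormSq_eq (α β : ℝ) (n : ℕ) :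
    jacobiNormSq α β n = 2 ^ (α + β + 1) * shiftedNormSq α β n := by
  have h := intervalIntegral.integral_comp_sub_mul (a := 0) (b := 1)
    (fun x => ((jacobiPoly α β n).eval x) ^ 2 * ((1 - x) ^ α * (1 + x) ^ β)) two_ne_zero 1
  rw [jacobiNormSq, integral_Icc_eq_integral_Ioc, ← intervalIntegral.integral_of_le (by norm_num)]
  have e : (∫ s in (0 : ℝ)..1, ((jacobiPoly α β n).eval (1 - 2 * s)) ^ 2 *
      ((1 - (1 - 2 * s)) ^ α * (1 + (1 - 2 * s)) ^ β)) =
      2 ^ (α + β) * shiftedNormSq α β n := by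
    rw [shiftedNormSq, ← intervalIntegral.integral_const_mul]
    refine intervalIntegral.integral_congr fun s hs => ?_
    rw [Set.uIcc_of_le zero_le_one] at hs
    simp only [eval_jacobiPoly]
    rw [show (1 : ℝ) - (1 - 2 * s) = 2 * s by ring,
      show (1 : ℝ) + (1 - 2 * s) = 2 * (1 - s) by ring, show 2 * s / 2 = s by ring,
      Real.mul_rpow zero_le_two hs.1, Real.mul_rpow zero_le_two (by linarith [hs.2]),
      Real.rpow_add zero_lt_two, jacobiWeight]
    ring
  rw [e] at h
  norm_num at h
  rw [Real.rpow_add_one two_ne_zero]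
  linarith

/-! ### Polynomial growth of the normalized products -/

/-- Sonin's argument: f = q² + s(1-s) q'² / κ dominates q², agrees with it at both endpoints, and by
the differential equation f' is q'² / κ times an affine function of nonnegative slope. The case n =
0 is separate because then κ = 0. -/
lemma shiftedJacobi_sq_le {α β : ℝ} (hα : -(1 / 2) ≤ α) (hβ : -(1 / 2) ≤ β) (n : ℕ) {s : ℝ}
    (hs : s ∈ Set.Icc (0 : ℝ) 1) :
    ((shiftedJacobi α β n).eval s) ^ 2 ≤
      ((shiftedJacobi α β n).eval 0) ^ 2 + ((shiftedJacobi α β n).eval 1) ^ 2 := by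
  rcases Nat.eq_zero_or_pos n with rfl | hn
  · have h : ∀ s, (shiftedJacobi α β 0).eval s = 1 := fun s => by simp [shiftedJacobi]
    simp [h]
  have hn1 : (1 : ℝ) ≤ n := by exact_mod_cast hn
  set κ : ℝ := n * (n + α + β + 1) with hκ
  have hκ0 : 0 < κ := mul_pos (by linarith) (by linarith)
  have hq := jacobiOp_shiftedJacobi α β n
  rw [← hκ] at hq
  set q := shiftedJacobi α β n
  set f : Polynomial ℝ := q ^ 2 + C κ⁻¹ * (X * (1 - X) * q.derivative ^ 2) with hf
  have hfe : ∀ u, f.eval u = (q.eval u) ^ 2 + κ⁻¹ * (u * (1 - u) * (q.derivative.eval u) ^ 2) := by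
    intro u; simp [hf]
  have hf0 : f.eval 0 = (q.eval 0) ^ 2 := by rw [hfe]; ring
  have hf1 : f.eval 1 = (q.eval 1) ^ 2 := by rw [hfe]; ring
  have hd : ∀ u, f.derivative.eval u =
      κ⁻¹ * ((q.derivative.eval u) ^ 2 * (2 * (α + β + 1) * u - (2 * α + 1))) := by
    intro u
    have h1 := congrArg (Polynomial.eval u) hq
    simp only [jacobiOp, Polynomial.eval_add, Polynomial.eval_mul, Polynomial.eval_sub,
      Polynomial.eval_X, Polynomial.eval_C, Polynomial.eval_one] at h1
    simp only [hf, Polynomial.derivative_add, Polynomial.derivative_mul, Polynomial.derivative_C,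
      Polynomial.derivative_sub, Polynomial.derivative_X, Polynomial.derivative_one,
      Polynomial.derivative_pow, Polynomial.eval_add, Polynomial.eval_mul, Polynomial.eval_sub,
      Polynomial.eval_X, Polynomial.eval_C, Polynomial.eval_one, Polynomial.eval_pow,
      Polynomial.eval_zero]
    push_cast
    simp only [pow_one]
    have h2 : κ⁻¹ * κ = 1 := inv_mul_cancel₀ hκ0.ne'
    linear_combination (2 * κ⁻¹ * q.derivative.eval u) * h1 -
      (2 * q.eval u * q.derivative.eval u) * h2
  have hle : (q.eval s) ^ 2 ≤ f.eval s := by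
    rw [hfe]
    have : 0 ≤ κ⁻¹ * (s * (1 - s) * (q.derivative.eval s) ^ 2) :=
      mul_nonneg (inv_pos.2 hκ0).le
        (mul_nonneg (mul_nonneg hs.1 (by linarith [hs.2])) (sq_nonneg _))
    linarith
  have hcont : ∀ t, ContinuousOn (fun u => f.eval u) t := fun t => f.continuous.continuousOn
  have hdiff : ∀ t, DifferentiableOn ℝ (fun u => f.eval u) t :=
    fun t => f.differentiable.differentiableOn
  refine hle.trans ?_
  -- If the affine factor is nonnegative at s, then f increases on [s,1]; otherwise f decreases on
  -- [0,s]. Either way f(s) is at most an endpoint value.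
  by_cases hsgn : 0 ≤ 2 * (α + β + 1) * s - (2 * α + 1)
  · have hmono : MonotoneOn (fun u => f.eval u) (Set.Icc s 1) := by
      refine monotoneOn_of_deriv_nonneg (convex_Icc s 1) (hcont _) (hdiff _) fun u hu => ?_
      rw [interior_Icc] at hu
      rw [Polynomial.deriv, hd]
      refine mul_nonneg (inv_pos.2 hκ0).le (mul_nonneg (sq_nonneg _) ?_)
      nlinarith [hu.1]
    have := hmono ⟨le_rfl, hs.2⟩ ⟨hs.2, le_rfl⟩ hs.2
    simp only [hf1] at this
    linarith [sq_nonneg (q.eval 0)]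
  · have hanti : AntitoneOn (fun u => f.eval u) (Set.Icc 0 s) := by
      refine antitoneOn_of_deriv_nonpos (convex_Icc 0 s) (hcont _) (hdiff _) fun u hu => ?_
      rw [interior_Icc] at hu
      rw [Polynomial.deriv, hd]
      refine mul_nonpos_of_nonneg_of_nonpos (inv_pos.2 hκ0).le
        (mul_nonpos_of_nonneg_of_nonpos (sq_nonneg _) ?_)
      nlinarith [hu.2]
    have := hanti ⟨le_rfl, hs.1⟩ ⟨hs.1, le_rfl⟩ hs.1
    simp only [hf0] at this
    linarith [sq_nonneg (q.eval 1)]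

/-- The normalized products of Jacobi polynomials in the variable `s`. -/
def jacobiProd (α β s σ : ℝ) (n : ℕ) : ℝ :=
  (shiftedJacobi α β n).eval s * (shiftedJacobi α β n).eval σ / shiftedNormSq α β n

lemma exists_growth_aux {α β : ℝ} (hα : -(1 / 2) ≤ α) (hβ : -(1 / 2) ≤ β) :
    ∃ (K : ℝ) (M : ℕ), 0 ≤ K ∧ ∀ n : ℕ,
      (poch (α + 1) n / n.factorial) ^ 2 / shiftedNormSq α β n ≤ K * ((n : ℝ) + 1) ^ M := by
  obtain ⟨C₁, hC₁, h₁⟩ := exists_poch_bounds (x := α + 1) (by linarith)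
  obtain ⟨C₂, hC₂, h₂⟩ := exists_poch_bounds (x := α + β + 2) (by linarith)
  obtain ⟨C₃, hC₃, h₃⟩ := exists_poch_bounds (x := β + 1) (by linarith)
  -- The exponents come from (α+1)_n, (α+β+2)_n and, in the denominator, (β+1)_n.
  obtain ⟨M, hM⟩ := exists_nat_ge (α + (α + β + 1) - β)
  have hB := ProbabilityTheory.beta_pos (α := α + 1) (β := β + 1) (by linarith) (by linarith)
  set B := ProbabilityTheory.beta (α + 1) (β + 1) with hBdef
  refine ⟨2 * C₁ * C₂ * C₃ / B, M, by positivity, fun n => ?_⟩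
  have hn : (0 : ℝ) < (n : ℝ) + 1 := by positivity
  have hn0 : (0 : ℝ) ≤ n := Nat.cast_nonneg n
  have pA := poch_pos (x := α + 1) (by linarith) n
  have pB := poch_pos (x := β + 1) (by linarith) n
  have pL := poch_pos (x := α + β + 2) (by linarith) n
  have pR := rbin_self_pos hα hβ n
  have hf : (0 : ℝ) < n.factorial := by exact_mod_cast n.factorial_pos
  -- For n ≥ 1, the ratio of (n+α+β+2)_n to (n+α+β+1)_n is (2n+α+β+1) / (n+α+β+1), at most 2.
  have hLR : poch (α + β + 2) (2 * n) ≤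
      2 * n.factorial * poch (α + β + 2) n * rbin (n + α + β + 1) n := by
    have e : 2 * n.factorial * poch (α + β + 2) n * rbin (n + α + β + 1) n =
        poch (α + β + 2) n * (2 * poch (n + α + β + 1) n) := by rw [rbin]; field_simp
    rw [e, two_mul n, poch_add]
    refine mul_le_mul_of_nonneg_left ?_ pL.le
    rcases n with _ | n
    · simp
    · have hn0' : (0 : ℝ) ≤ n := Nat.cast_nonneg n
      have p : 0 ≤ poch ((n + 1 : ℕ) + α + β + 1 + 1) n :=
        poch_nonneg (by push_cast; linarith) n
      rw [poch_succ' ((n + 1 : ℕ) + α + β + 1), poch_succ,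
        show α + β + 2 + ((n + 1 : ℕ) : ℝ) = (n + 1 : ℕ) + α + β + 1 + 1 by ring]
      have : ((n + 1 : ℕ) : ℝ) + α + β + 1 + 1 + n ≤ 2 * ((n + 1 : ℕ) + α + β + 1) := by
        push_cast; linarith
      nlinarith
  have e : (poch (α + 1) n / n.factorial) ^ 2 / shiftedNormSq α β n =
      poch (α + 1) n * poch (α + β + 2) (2 * n) /
        (n.factorial ^ 2 * rbin (n + α + β + 1) n * poch (β + 1) n * B) := by
    rw [shiftedNormSq_eq hα hβ, ← hBdef]
    have := poch_pos (x := α + β + 2) (by linarith) (2 * n)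
    field_simp
  rw [e, div_le_iff₀ (by positivity)]
  have hx : ((n : ℝ) + 1) ^ (α + 1 - 1) * ((n : ℝ) + 1) ^ (α + β + 2 - 1) ≤
      ((n : ℝ) + 1) ^ M * ((n : ℝ) + 1) ^ (β + 1 - 1) := by
    rw [← Real.rpow_natCast, ← Real.rpow_add hn, ← Real.rpow_add hn]
    exact Real.rpow_le_rpow_of_exponent_le (by linarith) (by linarith)
  have hc := (h₃ n).2
  calc poch (α + 1) n * poch (α + β + 2) (2 * n)
      ≤ (C₁ * (n.factorial * ((n : ℝ) + 1) ^ (α + 1 - 1))) *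
        (2 * n.factorial * (C₂ * (n.factorial * ((n : ℝ) + 1) ^ (α + β + 2 - 1))) *
          rbin (n + α + β + 1) n) := by
        refine mul_le_mul (h₁ n).1 (hLR.trans ?_) (poch_nonneg (by linarith) _) (by positivity)
        have := (h₂ n).1
        gcongr
    _ = 2 * C₁ * C₂ * n.factorial ^ 3 * rbin (n + α + β + 1) n *
        (((n : ℝ) + 1) ^ (α + 1 - 1) * ((n : ℝ) + 1) ^ (α + β + 2 - 1)) := by ring
    _ ≤ 2 * C₁ * C₂ * n.factorial ^ 3 * rbin (n + α + β + 1) n *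
        (((n : ℝ) + 1) ^ M * ((n : ℝ) + 1) ^ (β + 1 - 1)) := by gcongr
    _ = 2 * C₁ * C₂ * n.factorial ^ 2 * rbin (n + α + β + 1) n * ((n : ℝ) + 1) ^ M *
        (n.factorial * ((n : ℝ) + 1) ^ (β + 1 - 1)) := by ring
    _ ≤ 2 * C₁ * C₂ * n.factorial ^ 2 * rbin (n + α + β + 1) n * ((n : ℝ) + 1) ^ M *
        (C₃ * poch (β + 1) n) := by gcongr
    _ = _ := by field_simp

lemma shiftedNormSq_symm {α β : ℝ} (hα : -(1 / 2) ≤ α) (hβ : -(1 / 2) ≤ β) (n : ℕ) :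
    shiftedNormSq β α n = shiftedNormSq α β n := by
  rw [shiftedNormSq_eq hα hβ, shiftedNormSq_eq hβ hα, ProbabilityTheory.beta,
    ProbabilityTheory.beta, add_comm (β + 1), add_right_comm (n : ℝ) β α, add_comm β α,
    mul_comm (poch (β + 1) n), mul_comm (Real.Gamma (β + 1))]

lemma exists_jacobiProd_growth {α β : ℝ} (hα : -(1 / 2) ≤ α) (hβ : -(1 / 2) ≤ β) :
    ∃ (K : ℝ) (M : ℕ), ∀ s ∈ Set.Icc (0 : ℝ) 1, ∀ σ ∈ Set.Icc (0 : ℝ) 1, ∀ n : ℕ,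
      |jacobiProd α β s σ n| ≤ K * ((n : ℝ) + 1) ^ M := by
  obtain ⟨K₁, M₁, hK₁, h₁⟩ := exists_growth_aux hα hβ
  obtain ⟨K₂, M₂, hK₂, h₂⟩ := exists_growth_aux hβ hα
  refine ⟨K₁ + K₂, max M₁ M₂, fun s hs σ hσ n => ?_⟩
  have hI := shiftedNormSq_pos hα hβ n
  have a1 := shiftedJacobi_sq_le hα hβ n hs
  have a2 := shiftedJacobi_sq_le hα hβ n hσ
  rw [shiftedJacobi_eval_zero, shiftedJacobi_eval_one] at a1 a2
  have e : ((-1 : ℝ) ^ n * (poch (β + 1) n / n.factorial)) ^ 2 =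
      (poch (β + 1) n / n.factorial) ^ 2 := by
    rw [mul_pow, ← pow_mul, mul_comm n 2, pow_mul]; simp
  rw [e] at a1 a2
  have hn : (1 : ℝ) ≤ (n : ℝ) + 1 := by
    have : (0 : ℝ) ≤ n := Nat.cast_nonneg n
    linarith
  have b1 : (poch (α + 1) n / n.factorial) ^ 2 / shiftedNormSq α β n ≤
      K₁ * ((n : ℝ) + 1) ^ max M₁ M₂ := (h₁ n).trans
    (mul_le_mul_of_nonneg_left (pow_le_pow_right₀ hn (le_max_left _ _)) hK₁)
  have b2 : (poch (β + 1) n / n.factorial) ^ 2 / shiftedNormSq α β n ≤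
      K₂ * ((n : ℝ) + 1) ^ max M₁ M₂ := by
    rw [← shiftedNormSq_symm hα hβ]
    exact (h₂ n).trans (mul_le_mul_of_nonneg_left (pow_le_pow_right₀ hn (le_max_right _ _)) hK₂)
  rw [jacobiProd, abs_div, abs_of_pos hI]
  have c1 : |(shiftedJacobi α β n).eval s * (shiftedJacobi α β n).eval σ| ≤
      (poch (α + 1) n / n.factorial) ^ 2 + (poch (β + 1) n / n.factorial) ^ 2 := by
    rw [abs_le]
    constructor <;> nlinarith [sq_nonneg ((shiftedJacobi α β n).eval s +
      (shiftedJacobi α β n).eval σ), sq_nonneg ((shiftedJacobi α β n).eval s -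
      (shiftedJacobi α β n).eval σ)]
  calc _ ≤ ((poch (α + 1) n / n.factorial) ^ 2 + (poch (β + 1) n / n.factorial) ^ 2) /
        shiftedNormSq α β n := div_le_div_of_nonneg_right c1 hI.le
    _ ≤ _ := by rw [add_div, add_mul]; exact add_le_add b1 b2

lemma summable_jacobiProd {α β : ℝ} (hα : -(1 / 2) ≤ α) (hβ : -(1 / 2) ≤ β) {s σ : ℝ}
    (hs : s ∈ Set.Icc (0 : ℝ) 1) (hσ : σ ∈ Set.Icc (0 : ℝ) 1) {r : ℝ} (hr0 : 0 ≤ r)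
    (hr1 : r < 1) : Summable fun n => |jacobiProd α β s σ n| * r ^ n := by
  obtain ⟨K, M, h⟩ := exists_jacobiProd_growth hα hβ
  rcases hr0.eq_or_lt with rfl | hr
  · refine summable_of_ne_finset_zero (s := {0}) fun n hn => ?_
    simp only [mem_singleton] at hn
    simp [hn]
  have h1 : Summable fun n : ℕ => ((n : ℝ) + 1) ^ M * r ^ (n + 1) := by
    have := (summable_nat_add_iff 1).2 (summable_pow_mul_geometric_of_norm_lt_one (R := ℝ) M
      (r := r) (by rwa [Real.norm_of_nonneg hr0]))
    simpa using this
  refine Summable.of_nonneg_of_le (fun n => by positivity) (fun n => ?_)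
    (h1.mul_left (K * r⁻¹))
  calc |jacobiProd α β s σ n| * r ^ n ≤ (K * ((n : ℝ) + 1) ^ M) * r ^ n :=
        mul_le_mul_of_nonneg_right (h s hs σ hσ n) (by positivity)
    _ = _ := by rw [pow_succ]; field_simp

/-! ### Coefficients of Bailey's generating function -/

lemma hasSum_antidiagonal {f : ℕ × ℕ → ℝ} {a : ℝ} (hf : HasSum f a) :
    HasSum (fun n => ∑ p ∈ antidiagonal n, f p) a := by
  have h := HasAntidiagonal.sigmaAntidiagonalEquivProd.hasSum_iff.2 hf
  have h2 := h.sigma fun n => hasSum_fintype _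
  have e : (fun n => ∑ p ∈ antidiagonal n, f p) = fun n => ∑ b : antidiagonal n,
      (f ∘ HasAntidiagonal.sigmaAntidiagonalEquivProd) ⟨n, b⟩ := by
    funext n
    rw [← Finset.sum_coe_sort]
    rfl
  rw [e]
  exact h2

/-- The coefficients of `(1+z) (1-z)^(-μ)`. -/
def pbin (μ : ℝ) : ℕ → ℝ
  | 0 => 1
  | j + 1 => rbin μ (j + 1) + rbin μ j

lemma pbin_nonneg {μ : ℝ} (hμ : 0 ≤ μ) : ∀ j, 0 ≤ pbin μ j
  | 0 => zero_le_one
  | _ + 1 => add_nonneg (rbin_nonneg hμ _) (rbin_nonneg hμ _)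

lemma hasSum_pbin (μ : ℝ) {z : ℝ} (hz : |z| < 1) :
    HasSum (fun j => pbin μ j * z ^ j) ((1 + z) * (1 - z) ^ (-μ)) := by
  have h := hasSum_rbin μ hz
  have h1 := (hasSum_nat_add_iff' 1).2 h
  have h2 := h1.add (h.mul_left z)
  rw [← hasSum_nat_add_iff' 1]
  have e : (fun j => pbin μ (j + 1) * z ^ (j + 1)) =
      fun j => rbin μ (j + 1) * z ^ (j + 1) + z * (rbin μ j * z ^ j) := by
    funext j; simp only [pbin]; ring
  rw [e]
  convert h2 using 1
  simp [pbin, rbin]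
  ring

/-- The coefficients of Bailey's series as a power series in one variable. -/
def levelCoeff (α β x y : ℝ) (N : ℕ) : ℝ :=
  poch (α + β + 2) (2 * N) / 4 ^ N * bilevel α β x y N

lemma levelCoeff_nonneg {α β x y : ℝ} (hα : -1 < α) (hβ : -1 < β) (hx : 0 ≤ x) (hy : 0 ≤ y)
    (N : ℕ) : 0 ≤ levelCoeff α β x y N := by
  refine mul_nonneg (div_nonneg (poch_nonneg (by linarith) _) (by positivity))
    (sum_nonneg fun p _ => ?_)
  have := jw_nonneg hα p.1
  have := jw_nonneg hβ p.2
  positivity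

lemma hasSum_levelCoeff {α β : ℝ} (hα : -(1 / 2) ≤ α) (hβ : -(1 / 2) ≤ β) {ξ η : ℝ}
    (hξ : 0 ≤ ξ) (hη : 0 ≤ η) (h : ξ + η ≤ 1) {v : ℝ} (hv0 : 0 ≤ v) (hv1 : v < 1) :
    HasSum (fun N => levelCoeff α β (ξ ^ 2) (η ^ 2) N * (v ^ 2) ^ N)
      (baileySum α β (ξ * v) (η * v)) := by
  obtain ⟨_, _, hU⟩ := exists_baileySum_upper hα hβ
  have hs := (hU (ξ * v) (η * v) (by positivity) (by positivity) (by nlinarith)).1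
  have h2 := hasSum_antidiagonal hs.hasSum
  have e : (fun N => levelCoeff α β (ξ ^ 2) (η ^ 2) N * (v ^ 2) ^ N) =
      fun N => ∑ p ∈ antidiagonal N, baileyTerm α β (ξ * v) (η * v) p := by
    funext N
    rw [levelCoeff, bilevel, mul_sum, sum_mul]
    refine sum_congr rfl fun p hp => ?_
    rw [baileyTerm, mem_antidiagonal.1 hp, ← mem_antidiagonal.1 hp]
    simp only [mul_pow, pow_mul, pow_add]
    ring
  rw [e]
  exact h2

/-- This matches the coefficient of level N in Watson's sum of degree N + j with that of r^j in
(1-r)(1+r)^(-μ), where μ = α+β+2+2N. The signs come from (-n)_N = (-1)^N n!/j!. For j ≥ 1, the two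
binomial coefficients in `pbin` combine to produce the factor μ + 2j - 1, which is the last factor
of (α+β+2)_{2(N+j)}. -/
lemma watson_coeff (α β : ℝ) (N j : ℕ) :
    (-1) ^ (N + j) * poch (α + β + 2) (2 * (N + j)) *
        (poch (-((N + j : ℕ) : ℝ)) N * poch ((N + j : ℕ) + α + β + 1) N) =
      ((N + j).factorial * poch ((N + j : ℕ) + α + β + 1) (N + j)) *
        ((-1) ^ j * pbin (α + β + 2 + (2 * N : ℕ)) j * poch (α + β + 2) (2 * N)) := by
  have h1 : ((-1 : ℝ) ^ N) * (-1) ^ N = 1 := by rw [← mul_pow]; simp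
  rw [poch_neg_natCast (Nat.le_add_right N j), Nat.add_sub_cancel_left]
  have key : poch (α + β + 2) (2 * (N + j)) * poch ((N + j : ℕ) + α + β + 1) N =
      poch ((N + j : ℕ) + α + β + 1) (N + j) * (j.factorial *
        pbin (α + β + 2 + (2 * N : ℕ)) j * poch (α + β + 2) (2 * N)) := by
    rcases j with _ | i
    · simp [pbin]; ring
    · have hf : (i.factorial : ℝ) ≠ 0 := by exact_mod_cast i.factorial_ne_zero
      have hi : (i : ℝ) + 1 ≠ 0 := by positivity
      have e1 : 2 * (N + (i + 1)) = (N + i) + (N + (i + 1)) + 1 := by ring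
      have e2 : ((i + 1).factorial : ℝ) * pbin (α + β + 2 + (2 * N : ℕ)) (i + 1) *
          poch (α + β + 2) (2 * N) =
          poch (α + β + 2) (2 * N + i) * (α + β + 2 + 2 * N + 2 * i + 1) := by
        rw [poch_add, pbin, rbin, rbin, poch_succ, Nat.factorial_succ]
        push_cast
        field_simp
        ring
      have e3 : 2 * N + i = (N + i) + N := by ring
      have e4 : α + β + 2 + ((N + i : ℕ) : ℝ) = (N + (i + 1) : ℕ) + α + β + 1 := by
        push_cast; ring
      rw [e2, e1, poch_succ, e3, poch_add _ (N + i) (N + (i + 1)), poch_add _ (N + i) N, e4]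
      push_cast
      ring
  have hf : (j.factorial : ℝ) ≠ 0 := by exact_mod_cast j.factorial_ne_zero
  have hj : ((N + j).factorial : ℝ) / j.factorial * j.factorial = (N + j).factorial :=
    div_mul_cancel₀ _ hf
  rw [pow_add]
  set L₂ := poch (α + β + 2) (2 * (N + j))
  set P := poch ((N + j : ℕ) + α + β + 1) N
  set R := poch ((N + j : ℕ) + α + β + 1) (N + j)
  set pb := pbin (α + β + 2 + (2 * N : ℕ)) j
  set L := poch (α + β + 2) (2 * N)
  linear_combination ((-1) ^ j * (((N + j).factorial : ℝ) / j.factorial) * (L₂ * P)) * h1 +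
    ((-1) ^ j * (((N + j).factorial : ℝ) / j.factorial)) * key + ((-1) ^ j * R * pb * L) * hj

/-- The expansion of a normalized product of Jacobi polynomials. -/
lemma beta_mul_jacobiProd {α β : ℝ} (hα : -(1 / 2) ≤ α) (hβ : -(1 / 2) ≤ β) (s σ : ℝ) (n : ℕ) :
    ProbabilityTheory.beta (α + 1) (β + 1) * jacobiProd α β s σ n =
      ∑ p ∈ antidiagonal n, (-1) ^ p.2 * pbin (α + β + 2 + (2 * p.1 : ℕ)) p.2 *
        (4 ^ p.1 * levelCoeff α β (s * σ) ((1 - s) * (1 - σ)) p.1) := by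
  have hB := ProbabilityTheory.beta_pos (α := α + 1) (β := β + 1) (by linarith) (by linarith)
  have pA := poch_pos (x := α + 1) (by linarith) n
  have pB := poch_pos (x := β + 1) (by linarith) n
  have pL := poch_pos (x := α + β + 2) (by linarith) (2 * n)
  have pR := rbin_self_pos hα hβ n
  have hf : (0 : ℝ) < n.factorial := by exact_mod_cast n.factorial_pos
  have hp : 0 < poch (n + α + β + 1) n := by
    rw [rbin] at pR
    exact (div_pos_iff_of_pos_right hf).1 pR
  -- The endpoint values in Watson's formula cancel (α+1)_n (β+1)_n in the squared norm.
  have e : ProbabilityTheory.beta (α + 1) (β + 1) * jacobiProd α β s σ n =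
      (-1) ^ n * poch (α + β + 2) (2 * n) / (n.factorial * poch (n + α + β + 1) n) *
        (productPoly α β σ n).eval s := by
    rw [jacobiProd, shiftedJacobi_mul (by linarith) (by linarith), shiftedJacobi_eval_zero,
      shiftedJacobi_eval_one, shiftedNormSq_eq hα hβ, rbin]
    field_simp
  rw [e, eval_productPoly, Finset.Nat.sum_antidiagonal_eq_sum_range_succ_mk, mul_sum]
  refine sum_congr rfl fun N hN => ?_
  have hNn : N ≤ n := by have := mem_range.1 hN; omega
  obtain ⟨j, rfl⟩ := Nat.exists_eq_add_of_le hNn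
  have hw := watson_coeff α β N j
  rw [levelCoeff, Nat.add_sub_cancel_left]
  rw [div_mul_eq_mul_div, div_eq_iff (by positivity)]
  have h4 : (4 : ℝ) ^ N ≠ 0 := by positivity
  field_simp
  linear_combination (bilevel α β (s * σ) ((1 - s) * (1 - σ)) N) * hw

end

/-! ### The generating function by analytic continuation -/

section

open Finset Filter Topology MeasureTheory

lemma analyticOnNhd_tsum_pow {a : ℕ → ℝ}
    (h : ∀ r : ℝ, 0 ≤ r → r < 1 → Summable fun n => |a n| * r ^ n) :
    AnalyticOnNhd ℝ (fun r => ∑' n, a n * r ^ n) (Set.Ioo (-1) 1) := by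
  set p := FormalMultilinearSeries.ofScalars ℝ a with hp
  have hrad : 1 ≤ p.radius := by
    refine ENNReal.le_of_forall_nnreal_lt fun r hr => ?_
    refine p.le_radius_of_summable ?_
    have hr1 : (r : ℝ) < 1 := by exact_mod_cast hr
    simpa [hp, FormalMultilinearSeries.ofScalars_norm] using h r r.2 hr1
  have hb := p.hasFPowerSeriesOnBall (lt_of_lt_of_le one_pos hrad)
  have hsum : p.sum = fun r => ∑' n, a n * r ^ n := by
    funext r
    simp only [FormalMultilinearSeries.sum, hp, FormalMultilinearSeries.ofScalars_apply_eq,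
      smul_eq_mul]
  rw [← hsum]
  refine hb.analyticOnNhd.mono fun r hr => ?_
  refine Metric.eball_subset_eball hrad ?_
  rw [← ENNReal.ofReal_one, Metric.eball_ofReal, Metric.mem_ball, dist_zero_right,
    Real.norm_eq_abs, abs_lt]
  exact hr

lemma analyticOnNhd_one_add_rpow (μ : ℝ) :
    AnalyticOnNhd ℝ (fun r : ℝ => (1 + r) ^ μ) (Set.Ioo (-1) 1) := by
  refine (Real.one_add_rpow_hasFPowerSeriesOnBall_zero (a := μ)).analyticOnNhd.mono fun r hr => ?_
  rw [← ENNReal.ofReal_one, Metric.eball_ofReal, Metric.mem_ball, dist_zero_right,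
    Real.norm_eq_abs, abs_lt]
  exact hr

lemma four_mul_div_sq_mem {r : ℝ} (hr : r ∈ Set.Ioo (0 : ℝ) 1) :
    4 * r / (1 + r) ^ 2 ∈ Set.Ioo (0 : ℝ) 1 := by
  have h0 := hr.1
  have h1 := hr.2
  refine ⟨by positivity, ?_⟩
  rw [div_lt_one (by positivity)]
  nlinarith [sq_pos_of_pos (sub_pos.2 h1)]

lemma rpow_neg_add_two_mul {z : ℝ} (hz : 0 < z) (μ : ℝ) (N : ℕ) :
    z ^ (-(μ + (2 * N : ℕ))) = z ^ (-μ) * ((z ^ 2) ^ N)⁻¹ := by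
  rw [neg_add, Real.rpow_add hz, Real.rpow_neg hz.le (((2 * N : ℕ) : ℝ)), Real.rpow_natCast,
    pow_mul]

/-- The closed form of the generating function for small `r`. -/
lemma tsum_jacobiProd_of_small {α β : ℝ} (hα : -(1 / 2) ≤ α) (hβ : -(1 / 2) ≤ β) {s σ : ℝ}
    (hs : s ∈ Set.Icc (0 : ℝ) 1) (hσ : σ ∈ Set.Icc (0 : ℝ) 1)
    (hL : ∀ u : ℝ, 0 ≤ u → u < 1 →
      Summable fun N => levelCoeff α β (s * σ) ((1 - s) * (1 - σ)) N * u ^ N)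
    {r : ℝ} (hr0 : 0 ≤ r) (hr : r ≤ 1 / 10) :
    ProbabilityTheory.beta (α + 1) (β + 1) * ∑' n, jacobiProd α β s σ n * r ^ n =
      (1 - r) * (1 + r) ^ (-(α + β + 2)) *
        ∑' N, levelCoeff α β (s * σ) ((1 - s) * (1 - σ)) N * (4 * r / (1 + r) ^ 2) ^ N := by
  set d := levelCoeff α β (s * σ) ((1 - s) * (1 - σ)) with hd
  have hd0 : ∀ N, 0 ≤ d N := levelCoeff_nonneg (by linarith) (by linarith)
    (mul_nonneg hs.1 hσ.1) (mul_nonneg (by linarith [hs.2]) (by linarith [hσ.2]))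
  have hμ : ∀ N : ℕ, 0 ≤ α + β + 2 + (2 * N : ℕ) := fun N =>
    add_nonneg (by linarith) (Nat.cast_nonneg _)
  have hrabs : |r| < 1 := by rw [abs_of_nonneg hr0]; linarith
  have hrabs' : |-r| < 1 := by rwa [abs_neg]
  set f : ℕ × ℕ → ℝ := fun p =>
    4 ^ p.1 * d p.1 * r ^ p.1 * (pbin (α + β + 2 + (2 * p.1 : ℕ)) p.2 * (-r) ^ p.2) with hf
  have hfabs : ∀ p, |f p| =
      4 ^ p.1 * d p.1 * r ^ p.1 * (pbin (α + β + 2 + (2 * p.1 : ℕ)) p.2 * r ^ p.2) := by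
    intro p
    simp only [hf, abs_mul, abs_pow, abs_neg, abs_of_nonneg hr0, abs_of_nonneg (hd0 p.1),
      abs_of_nonneg (pbin_nonneg (hμ p.1) p.2)]
    norm_num
  -- Taking absolute values turns -r into r, so the levels are evaluated at 4r/(1-r)² instead of
  -- 4r/(1+r)². This is below 1 for r ≤ 1/10 but not for all r < 1, hence the restriction to small
  -- r.
  have hfsum : Summable f := by
    refine Summable.of_abs ?_
    have hin : ∀ N : ℕ, HasSum (fun j => |f (N, j)|)
        ((1 + r) * (1 - r) ^ (-(α + β + 2)) * (d N * (4 * r / (1 - r) ^ 2) ^ N)) := by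
      intro N
      simp only [hfabs]
      have h1 := (hasSum_pbin (α + β + 2 + (2 * N : ℕ)) hrabs).mul_left (4 ^ N * d N * r ^ N)
      rw [rpow_neg_add_two_mul (by linarith)] at h1
      have e : (1 + r) * (1 - r) ^ (-(α + β + 2)) * (d N * (4 * r / (1 - r) ^ 2) ^ N) =
          4 ^ N * d N * r ^ N * ((1 + r) * ((1 - r) ^ (-(α + β + 2)) * (((1 - r) ^ 2) ^ N)⁻¹)) := by
        rw [div_pow, mul_pow]; ring
      rw [e]
      exact h1
    have hu0 : 0 ≤ 4 * r / (1 - r) ^ 2 := by positivity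
    have hu1 : 4 * r / (1 - r) ^ 2 < 1 := by
      rw [div_lt_one (by nlinarith)]; nlinarith
    exact (hasSum_prod_of_nonneg (fun p => abs_nonneg _) hin
      ((hL _ hu0 hu1).mul_left _).hasSum).summable
  have hin : ∀ N : ℕ, HasSum (fun j => f (N, j))
      ((1 - r) * (1 + r) ^ (-(α + β + 2)) * (d N * (4 * r / (1 + r) ^ 2) ^ N)) := by
    intro N
    have h1 := (hasSum_pbin (α + β + 2 + (2 * N : ℕ)) hrabs').mul_left (4 ^ N * d N * r ^ N)
    rw [sub_neg_eq_add, rpow_neg_add_two_mul (by linarith)] at h1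
    have e : (1 - r) * (1 + r) ^ (-(α + β + 2)) * (d N * (4 * r / (1 + r) ^ 2) ^ N) =
        4 ^ N * d N * r ^ N * ((1 + -r) * ((1 + r) ^ (-(α + β + 2)) * (((1 + r) ^ 2) ^ N)⁻¹)) := by
      rw [div_pow, mul_pow]; ring
    rw [e]
    exact h1
  have h1 := hfsum.hasSum.prod_fiberwise hin
  have h2 := hasSum_antidiagonal hfsum.hasSum
  have e2 : (fun n => ∑ p ∈ antidiagonal n, f p) = fun n =>
      ProbabilityTheory.beta (α + 1) (β + 1) * (jacobiProd α β s σ n * r ^ n) := by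
    funext n
    rw [← mul_assoc, beta_mul_jacobiProd hα hβ, sum_mul]
    refine sum_congr rfl fun p hp => ?_
    rw [← mem_antidiagonal.1 hp, pow_add]
    simp only [hf, neg_pow r]
    ring
  rw [e2] at h2
  rw [← tsum_mul_left, ← tsum_mul_left, h2.tsum_eq, h1.tsum_eq]

/-- Bailey's generating function for products of Jacobi polynomials. -/
lemma beta_mul_tsum_jacobiProd {α β : ℝ} (hα : -(1 / 2) ≤ α) (hβ : -(1 / 2) ≤ β) {s σ : ℝ}
    (hs : s ∈ Set.Icc (0 : ℝ) 1) (hσ : σ ∈ Set.Icc (0 : ℝ) 1)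
    (hL : ∀ u : ℝ, 0 ≤ u → u < 1 →
      Summable fun N => levelCoeff α β (s * σ) ((1 - s) * (1 - σ)) N * u ^ N)
    {r : ℝ} (hr : r ∈ Set.Ioo (0 : ℝ) 1) :
    ProbabilityTheory.beta (α + 1) (β + 1) * ∑' n, jacobiProd α β s σ n * r ^ n =
      (1 - r) * (1 + r) ^ (-(α + β + 2)) *
        ∑' N, levelCoeff α β (s * σ) ((1 - s) * (1 - σ)) N * (4 * r / (1 + r) ^ 2) ^ N := by
  have hd0 : ∀ N, 0 ≤ levelCoeff α β (s * σ) ((1 - s) * (1 - σ)) N :=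
    levelCoeff_nonneg (by linarith) (by linarith)
      (mul_nonneg hs.1 hσ.1) (mul_nonneg (by linarith [hs.2]) (by linarith [hσ.2]))
  have hsub : Set.Ioo (0 : ℝ) 1 ⊆ Set.Ioo (-1) 1 := Set.Ioo_subset_Ioo_left (by norm_num)
  have hA : AnalyticOnNhd ℝ (fun r : ℝ => ProbabilityTheory.beta (α + 1) (β + 1) *
      ∑' n, jacobiProd α β s σ n * r ^ n) (Set.Ioo 0 1) :=
    analyticOnNhd_const.mul ((analyticOnNhd_tsum_pow
      fun r h0 h1 => summable_jacobiProd hα hβ hs hσ h0 h1).mono hsub)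
  have hu : AnalyticOnNhd ℝ (fun r : ℝ => 4 * r / (1 + r) ^ 2) (Set.Ioo 0 1) := by
    refine (analyticOnNhd_const.mul analyticOnNhd_id).div
      ((analyticOnNhd_const.add analyticOnNhd_id).pow 2) fun r hr => ?_
    have h0 := hr.1
    have h1 : (1 + r) ^ 2 ≠ 0 := by positivity
    exact h1
  have hcomp := (analyticOnNhd_tsum_pow (a := levelCoeff α β (s * σ) ((1 - s) * (1 - σ)))
    fun r h0 h1 => by simpa only [abs_of_nonneg (hd0 _)] using hL r h0 h1).comp
      (s := Set.Ioo (0 : ℝ) 1) hu (fun r hr => hsub (four_mul_div_sq_mem hr))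
  have hB : AnalyticOnNhd ℝ (fun r : ℝ => (1 - r) * (1 + r) ^ (-(α + β + 2)) *
      ∑' N, levelCoeff α β (s * σ) ((1 - s) * (1 - σ)) N * (4 * r / (1 + r) ^ 2) ^ N)
      (Set.Ioo 0 1) :=
    ((analyticOnNhd_const.sub analyticOnNhd_id).mul
      ((analyticOnNhd_one_add_rpow _).mono hsub)).mul hcomp
  -- Both sides are analytic on (0,1) and agree near 1/20, hence everywhere on the interval.
  refine hA.eqOn_of_preconnected_of_eventuallyEq hB isPreconnected_Ioo
    (z₀ := 1 / 20) ⟨by norm_num, by norm_num⟩ ?_ hr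
  filter_upwards [Ioo_mem_nhds (a := (0 : ℝ)) (b := 1 / 10) (x := 1 / 20) (by norm_num)
    (by norm_num)] with r hr
  exact tsum_jacobiProd_of_small hα hβ hs hσ hL hr.1.le hr.2.le

/-! ### Closed formula for the kernel -/

lemma one_sub_cos_div_two (θ : ℝ) : (1 - Real.cos θ) / 2 = Real.sin (θ / 2) ^ 2 := by
  have := Real.cos_sq (θ / 2)
  rw [mul_div_cancel₀ _ two_ne_zero] at this
  have h2 := Real.sin_sq_add_cos_sq (θ / 2)
  linarith

/-- The substitution x = 1 - 2s contributes 2^(α+β+1) to the squared norm, which the normalizing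
constants cancel. -/
lemma trigJacobi_mul {α β : ℝ} (hα : -(1 / 2) ≤ α) (hβ : -(1 / 2) ≤ β) (n : ℕ) (θ φ : ℝ) :
    trigJacobi α β n θ * trigJacobi α β n φ =
      jacobiProd α β (Real.sin (θ / 2) ^ 2) (Real.sin (φ / 2) ^ 2) n := by
  have hI := shiftedNormSq_pos hα hβ n
  have h2 : (0 : ℝ) < 2 ^ (α + β + 1) := by positivity
  have e1 : (2 : ℝ) ^ ((α + β + 1) / 2) * 2 ^ ((α + β + 1) / 2) = 2 ^ (α + β + 1) := by
    rw [← Real.rpow_add zero_lt_two, add_halves]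
  have hN : 0 < jacobiNormSq α β n := by rw [jacobiNormSq_eq]; positivity
  have e2 : jacobiNormSq α β n ^ (-(1 / 2) : ℝ) * jacobiNormSq α β n ^ (-(1 / 2) : ℝ) =
      (2 ^ (α + β + 1) * shiftedNormSq α β n)⁻¹ := by
    rw [← Real.rpow_add hN, ← jacobiNormSq_eq, ← Real.rpow_neg_one]
    norm_num
  rw [trigJacobi, trigJacobi, eval_jacobiPoly, eval_jacobiPoly, one_sub_cos_div_two,
    one_sub_cos_div_two, jacobiProd]
  calc _ = ((2 : ℝ) ^ ((α + β + 1) / 2) * 2 ^ ((α + β + 1) / 2)) *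
        (jacobiNormSq α β n ^ (-(1 / 2) : ℝ) * jacobiNormSq α β n ^ (-(1 / 2) : ℝ)) *
        ((shiftedJacobi α β n).eval (Real.sin (θ / 2) ^ 2) *
          (shiftedJacobi α β n).eval (Real.sin (φ / 2) ^ 2)) := by ring
    _ = _ := by rw [e1, e2]; field_simp

lemma poissonKernel_term {α β : ℝ} (hα : -(1 / 2) ≤ α) (hβ : -(1 / 2) ≤ β) (t θ φ : ℝ) (n : ℕ) :
    Real.exp (-t * |(n : ℝ) + (α + β + 1) / 2|) * trigJacobi α β n θ * trigJacobi α β n φ =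
      Real.exp (-t * ((α + β + 1) / 2)) *
        (jacobiProd α β (Real.sin (θ / 2) ^ 2) (Real.sin (φ / 2) ^ 2) n * Real.exp (-t) ^ n) := by
  have hn : (0 : ℝ) ≤ n := Nat.cast_nonneg n
  rw [mul_assoc, trigJacobi_mul hα hβ, abs_of_nonneg (by linarith), ← Real.exp_nat_mul, mul_add,
    Real.exp_add, mul_comm (n : ℝ)]
  ring

lemma exp_neg_lt_one {t : ℝ} (ht : 0 < t) : Real.exp (-t) < 1 := by
  rw [← Real.exp_zero]
  exact Real.exp_lt_exp.2 (by linarith)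

lemma sin_sq_mem_Icc (x : ℝ) : Real.sin x ^ 2 ∈ Set.Icc (0 : ℝ) 1 :=
  ⟨sq_nonneg _, Real.sin_sq_le_one x⟩

lemma summable_poissonKernel {α β : ℝ} (hα : -(1 / 2) ≤ α) (hβ : -(1 / 2) ≤ β) {t : ℝ}
    (ht : 0 < t) (θ φ : ℝ) : Summable fun n : ℕ =>
      Real.exp (-t * |(n : ℝ) + (α + β + 1) / 2|) * trigJacobi α β n θ * trigJacobi α β n φ := by
  simp only [poissonKernel_term hα hβ]
  refine Summable.mul_left _ (Summable.of_abs ?_)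
  have := summable_jacobiProd hα hβ (sin_sq_mem_Icc (θ / 2)) (sin_sq_mem_Icc (φ / 2))
    (Real.exp_pos (-t)).le (exp_neg_lt_one ht)
  simpa only [abs_mul, abs_pow, Real.abs_exp] using this

lemma exp_neg_eq_cosh (t : ℝ) :
    1 + Real.exp (-t) = 2 * Real.exp (-(t / 2)) * Real.cosh (t / 2) ∧
      1 - Real.exp (-t) = 2 * Real.exp (-(t / 2)) * Real.sinh (t / 2) := by
  have h1 : Real.exp (-(t / 2)) * Real.exp (t / 2) = 1 := by rw [← Real.exp_add]; simp
  have h2 : Real.exp (-(t / 2)) * Real.exp (-(t / 2)) = Real.exp (-t) := by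
    rw [← Real.exp_add]; congr 1; ring
  rw [Real.cosh_eq, Real.sinh_eq]
  constructor <;> linarith

/-- The closed formula for the Poisson–Jacobi kernel. -/
lemma poissonKernel_eq {α β : ℝ} (hα : -(1 / 2) ≤ α) (hβ : -(1 / 2) ≤ β) {t θ φ : ℝ} (ht : 0 < t)
    (hθ : θ ∈ Set.Icc 0 Real.pi) (hφ : φ ∈ Set.Icc 0 Real.pi) :
    poissonKernel α β t θ φ = 2 ^ (-(α + β + 1)) * (ProbabilityTheory.beta (α + 1) (β + 1))⁻¹ *
      (Real.sinh (t / 2) * Real.cosh (t / 2) ^ (-(α + β + 2)) *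
        baileySum α β (Real.sin (θ / 2) * Real.sin (φ / 2) * (Real.cosh (t / 2))⁻¹)
          (Real.cos (θ / 2) * Real.cos (φ / 2) * (Real.cosh (t / 2))⁻¹)) := by
  have hB := ProbabilityTheory.beta_pos (α := α + 1) (β := β + 1) (by linarith) (by linarith)
  have s1 : 0 ≤ Real.sin (θ / 2) :=
    Real.sin_nonneg_of_nonneg_of_le_pi (by linarith [hθ.1]) (by linarith [hθ.2, Real.pi_pos])
  have s2 : 0 ≤ Real.sin (φ / 2) :=
    Real.sin_nonneg_of_nonneg_of_le_pi (by linarith [hφ.1]) (by linarith [hφ.2, Real.pi_pos])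
  have c1 : 0 ≤ Real.cos (θ / 2) :=
    Real.cos_nonneg_of_neg_pi_div_two_le_of_le (by linarith [hθ.1, Real.pi_pos])
      (by linarith [hθ.2])
  have c2 : 0 ≤ Real.cos (φ / 2) :=
    Real.cos_nonneg_of_neg_pi_div_two_le_of_le (by linarith [hφ.1, Real.pi_pos])
      (by linarith [hφ.2])
  have hle : Real.sin (θ / 2) * Real.sin (φ / 2) + Real.cos (θ / 2) * Real.cos (φ / 2) ≤ 1 := by
    have := Real.cos_le_one (θ / 2 - φ / 2)
    rw [Real.cos_sub] at this
    linarith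
  have hx : Real.sin (θ / 2) ^ 2 * Real.sin (φ / 2) ^ 2 =
      (Real.sin (θ / 2) * Real.sin (φ / 2)) ^ 2 := (mul_pow _ _ 2).symm
  have hy : (1 - Real.sin (θ / 2) ^ 2) * (1 - Real.sin (φ / 2) ^ 2) =
      (Real.cos (θ / 2) * Real.cos (φ / 2)) ^ 2 := by
    rw [← Real.cos_sq', ← Real.cos_sq', mul_pow]
  have hch : 1 < Real.cosh (t / 2) := Real.one_lt_cosh.2 (by positivity)
  have hch0 : 0 < Real.cosh (t / 2) := by linarith
  have hr : Real.exp (-t) ∈ Set.Ioo (0 : ℝ) 1 :=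
    ⟨Real.exp_pos _, exp_neg_lt_one ht⟩
  have hgen := beta_mul_tsum_jacobiProd hα hβ (sin_sq_mem_Icc (θ / 2)) (sin_sq_mem_Icc (φ / 2))
    (fun u hu0 hu1 => by
      have := (hasSum_levelCoeff hα hβ (mul_nonneg s1 s2) (mul_nonneg c1 c2) hle
        (Real.sqrt_nonneg u) (by rwa [Real.sqrt_lt' one_pos, one_pow])).summable
      rwa [Real.sq_sqrt hu0, ← hx, ← hy] at this) hr
  obtain ⟨e1, e2⟩ := exp_neg_eq_cosh t
  have he : 0 < Real.exp (-(t / 2)) := Real.exp_pos _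
  have hv : 4 * Real.exp (-t) / (1 + Real.exp (-t)) ^ 2 = (Real.cosh (t / 2))⁻¹ ^ 2 := by
    have h2 : Real.exp (-t) = Real.exp (-(t / 2)) ^ 2 := by
      rw [sq, ← Real.exp_add]; congr 1; ring
    rw [e1, h2]
    field_simp
    norm_num
  have hsum := (hasSum_levelCoeff hα hβ (mul_nonneg s1 s2) (mul_nonneg c1 c2) hle
    (inv_nonneg.2 hch0.le) (inv_lt_one_of_one_lt₀ hch)).tsum_eq
  rw [hv, hx, hy, hsum, e2, e1] at hgen
  rw [Real.mul_rpow (by positivity) hch0.le, Real.mul_rpow zero_le_two he.le,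
    ← Real.exp_mul] at hgen
  -- Writing 1 ± r through cosh and sinh releases powers of e^(-t/2) which cancel the exponential
  -- prefactor exactly.
  have hexp : Real.exp (-t * ((α + β + 1) / 2)) * (Real.exp (-(t / 2)) *
      Real.exp (-(t / 2) * -(α + β + 2))) = 1 := by
    have h0 : -t * ((α + β + 1) / 2) + (-(t / 2) + -(t / 2) * -(α + β + 2)) = 0 := by ring
    rw [← Real.exp_add, ← Real.exp_add, h0, Real.exp_zero]
  have h2p : (2 : ℝ) * 2 ^ (-(α + β + 2)) = 2 ^ (-(α + β + 1)) := by
    rw [show -(α + β + 1) = -(α + β + 2) + 1 by ring, Real.rpow_add_one two_ne_zero, mul_comm]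
  rw [poissonKernel]
  simp only [poissonKernel_term hα hβ]
  rw [tsum_mul_left, ← h2p]
  rw [← eq_inv_mul_iff_mul_eq₀ hB.ne'] at hgen
  rw [hgen]
  linear_combination (2 * 2 ^ (-(α + β + 2)) * (ProbabilityTheory.beta (α + 1) (β + 1))⁻¹ *
      (Real.sinh (t / 2) * Real.cosh (t / 2) ^ (-(α + β + 2)) *
        baileySum α β (Real.sin (θ / 2) * Real.sin (φ / 2) * (Real.cosh (t / 2))⁻¹)
          (Real.cos (θ / 2) * Real.cos (φ / 2) * (Real.cosh (t / 2))⁻¹))) * hexp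

/-! ### Comparability and the model expression -/

/-- `X` and `Y` agree up to the factor `C`. -/
def Comparable (C X Y : ℝ) : Prop := X ≤ C * Y ∧ Y ≤ C * X

lemma Comparable.trans {C C' X Y Z : ℝ} (h : Comparable C X Y) (h' : Comparable C' Y Z)
    (hC : 0 ≤ C) (hC' : 0 ≤ C') : Comparable (C * C') X Z := by
  refine ⟨h.1.trans ?_, h'.2.trans ?_⟩
  · rw [mul_assoc]; exact mul_le_mul_of_nonneg_left h'.1 hC
  · rw [mul_comm C, mul_assoc]; exact mul_le_mul_of_nonneg_left h.2 hC'

lemma Comparable.mul {C C' X Y X' Y' : ℝ} (h : Comparable C X Y) (h' : Comparable C' X' Y')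
    (hX : 0 ≤ X) (hY : 0 ≤ Y) (hX' : 0 ≤ X') (hY' : 0 ≤ Y') (hC : 0 ≤ C) :
    Comparable (C * C') (X * X') (Y * Y') := by
  constructor
  · rw [mul_mul_mul_comm]; exact mul_le_mul h.1 h'.1 hX' (mul_nonneg hC hY)
  · rw [mul_mul_mul_comm]; exact mul_le_mul h.2 h'.2 hY' (mul_nonneg hC hX)

lemma Comparable.rpow_neg {C X Y a : ℝ} (h : Comparable C X Y) (hX : 0 < X) (hY : 0 < Y)
    (hC : 0 < C) (ha : 0 ≤ a) : Comparable (C ^ a) (X ^ (-a)) (Y ^ (-a)) := by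
  have key : ∀ X Y : ℝ, 0 < X → 0 < Y → Y ≤ C * X → X ^ (-a) ≤ C ^ a * Y ^ (-a) := by
    intro X Y hX hY h
    have h1 := Real.rpow_le_rpow hY.le h ha
    rw [Real.mul_rpow hC.le hX.le] at h1
    have p1 := Real.rpow_pos_of_pos hX a
    have p2 := Real.rpow_pos_of_pos hY a
    rw [Real.rpow_neg hX.le, Real.rpow_neg hY.le, ← div_eq_mul_inv, le_div_iff₀ p2,
      inv_mul_le_iff₀ p1, mul_comm]
    exact h1
  exact ⟨key X Y hX hY h.2, key Y X hY hX h.1⟩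

lemma Comparable.inv {C X Y : ℝ} (h : Comparable C X Y) (hX : 0 < X) (hY : 0 < Y)
    (hC : 0 < C) : Comparable C X⁻¹ Y⁻¹ := by
  simpa only [Real.rpow_one, Real.rpow_neg_one] using h.rpow_neg hX hY hC zero_le_one

lemma Comparable.const_mul {C X Y k : ℝ} (h : Comparable C X Y) (hk : 0 < k) (hC : 0 ≤ C)
    (hX : 0 ≤ X) (hY : 0 ≤ Y) : Comparable ((k + k⁻¹) * C) (k * X) Y := by
  have hki : 0 < k⁻¹ := inv_pos.2 hk
  constructor
  · calc k * X ≤ k * (C * Y) := mul_le_mul_of_nonneg_left h.1 hk.le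
      _ ≤ (k + k⁻¹) * C * Y := by
        have : 0 ≤ k⁻¹ * (C * Y) := by positivity
        linarith
  · calc Y ≤ C * X := h.2
      _ = k⁻¹ * (C * (k * X)) := by field_simp
      _ ≤ (k + k⁻¹) * C * (k * X) := by
        have : 0 ≤ k * (C * (k * X)) := by positivity
        linarith

/-- The elementary expression comparable with the kernel for all `t > 0`. -/
def kernelModel (α β t θ φ : ℝ) : ℝ :=
  (Real.cosh (t / 2) - Real.cos (θ / 2) * Real.cos (φ / 2)) ^ (-(α + 1 / 2)) *
    (Real.cosh (t / 2) - Real.sin (θ / 2) * Real.sin (φ / 2)) ^ (-(β + 1 / 2)) *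
    (Real.sinh (t / 2) * (Real.cosh (t / 2) - Real.cos ((θ - φ) / 2))⁻¹)

/-- The bounds for Bailey's sum are inserted into the closed formula. By the addition formula, 1 - ξ
- η becomes cosh(t/2) - cos((θ-φ)/2), divided by cosh(t/2). -/
lemma exists_comparable_kernelModel {α β : ℝ} (hα : -(1 / 2) ≤ α) (hβ : -(1 / 2) ≤ β) :
    ∃ C, 0 < C ∧ ∀ t θ φ : ℝ, 0 < t → θ ∈ Set.Icc 0 Real.pi → φ ∈ Set.Icc 0 Real.pi →
      Comparable C (poissonKernel α β t θ φ) (kernelModel α β t θ φ) := by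
  obtain ⟨C₁, hC₁, hU⟩ := exists_baileySum_upper hα hβ
  obtain ⟨C₂, hC₂, hL⟩ := exists_baileySum_lower hα hβ
  have hB := ProbabilityTheory.beta_pos (α := α + 1) (β := β + 1) (by linarith) (by linarith)
  set k : ℝ := 2 ^ (-(α + β + 1)) * (ProbabilityTheory.beta (α + 1) (β + 1))⁻¹ with hk
  have hk0 : 0 < k := by positivity
  refine ⟨(k + k⁻¹) * max C₁ C₂, by positivity, fun t θ φ ht hθ hφ => ?_⟩
  have s1 : 0 ≤ Real.sin (θ / 2) :=
    Real.sin_nonneg_of_nonneg_of_le_pi (by linarith [hθ.1]) (by linarith [hθ.2, Real.pi_pos])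
  have s2 : 0 ≤ Real.sin (φ / 2) :=
    Real.sin_nonneg_of_nonneg_of_le_pi (by linarith [hφ.1]) (by linarith [hφ.2, Real.pi_pos])
  have c1 : 0 ≤ Real.cos (θ / 2) :=
    Real.cos_nonneg_of_neg_pi_div_two_le_of_le (by linarith [hθ.1, Real.pi_pos])
      (by linarith [hθ.2])
  have c2 : 0 ≤ Real.cos (φ / 2) :=
    Real.cos_nonneg_of_neg_pi_div_two_le_of_le (by linarith [hφ.1, Real.pi_pos])
      (by linarith [hφ.2])
  have hcos : Real.cos ((θ - φ) / 2) =
      Real.cos (θ / 2) * Real.cos (φ / 2) + Real.sin (θ / 2) * Real.sin (φ / 2) := by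
    rw [sub_div, Real.cos_sub]
  have hle := Real.cos_le_one ((θ - φ) / 2)
  have hch : 1 < Real.cosh (t / 2) := Real.one_lt_cosh.2 (by positivity)
  have hsh : 0 < Real.sinh (t / 2) := Real.sinh_pos_iff.2 (by positivity)
  rw [poissonKernel_eq hα hβ ht hθ hφ, ← hk, kernelModel, hcos]
  rw [hcos] at hle
  have hξ0 := mul_nonneg s1 s2
  have hη0 := mul_nonneg c1 c2
  set ξ := Real.sin (θ / 2) * Real.sin (φ / 2)
  set η := Real.cos (θ / 2) * Real.cos (φ / 2)
  set ch := Real.cosh (t / 2)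
  set sh := Real.sinh (t / 2)
  have hch0 : 0 < ch := by linarith
  have h1 : 0 ≤ ξ * ch⁻¹ := by positivity
  have h2 : 0 ≤ η * ch⁻¹ := by positivity
  have h3 : ξ * ch⁻¹ + η * ch⁻¹ < 1 := by
    rw [← add_mul, ← div_eq_mul_inv, div_lt_one hch0]; linarith
  have d1 : 0 < ch - η := by linarith
  have d2 : 0 < ch - ξ := by linarith
  have d3 : 0 < ch - (η + ξ) := by linarith
  have hmodel : sh * ch ^ (-(α + β + 2)) *
      ((1 - η * ch⁻¹) ^ (-(α + 1 / 2)) * ((1 - ξ * ch⁻¹) ^ (-(β + 1 / 2)) *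
        (1 - ξ * ch⁻¹ - η * ch⁻¹)⁻¹)) =
      (ch - η) ^ (-(α + 1 / 2)) * (ch - ξ) ^ (-(β + 1 / 2)) * (sh * (ch - (η + ξ))⁻¹) := by
    have e1 : 1 - η * ch⁻¹ = (ch - η) * ch⁻¹ := by field_simp
    have e2 : 1 - ξ * ch⁻¹ = (ch - ξ) * ch⁻¹ := by field_simp
    have e3 : 1 - ξ * ch⁻¹ - η * ch⁻¹ = (ch - (η + ξ)) * ch⁻¹ := by field_simp; ring
    have hi : 0 ≤ ch⁻¹ := inv_nonneg.2 hch0.le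
    rw [e3, e1, e2, Real.mul_rpow d1.le hi, Real.mul_rpow d2.le hi, mul_inv, inv_inv,
      Real.inv_rpow hch0.le, Real.inv_rpow hch0.le, ← Real.rpow_neg hch0.le,
      ← Real.rpow_neg hch0.le, neg_neg, neg_neg]
    -- The exponents α + 1/2, β + 1/2 and 1 released by the three factors add up to α + β + 2, so no
    -- power of cosh(t/2) survives.
    have hpow : ch ^ (-(α + β + 2)) * (ch ^ (α + 1 / 2) * (ch ^ (β + 1 / 2) * ch)) = 1 := by
      have h0 : -(α + β + 2) + (α + 1 / 2 + (β + 1 / 2 + 1)) = 0 := by ring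
      rw [← Real.rpow_add_one hch0.ne', ← Real.rpow_add hch0, ← Real.rpow_add hch0, h0,
        Real.rpow_zero]
    linear_combination ((ch - η) ^ (-(α + 1 / 2)) * (ch - ξ) ^ (-(β + 1 / 2)) *
      (sh * (ch - (η + ξ))⁻¹)) * hpow
  have hw : 0 < sh * ch ^ (-(α + β + 2)) := mul_pos hsh (Real.rpow_pos_of_pos hch0 _)
  have hSn : 0 ≤ baileySum α β (ξ * ch⁻¹) (η * ch⁻¹) :=
    tsum_nonneg (baileyTerm_nonneg (by linarith) (by linarith) _ _)
  have hMn : 0 ≤ (ch - η) ^ (-(α + 1 / 2)) * (ch - ξ) ^ (-(β + 1 / 2)) *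
      (sh * (ch - (η + ξ))⁻¹) :=
    mul_nonneg (mul_nonneg (Real.rpow_nonneg d1.le _) (Real.rpow_nonneg d2.le _))
      (mul_nonneg hsh.le (inv_nonneg.2 d3.le))
  refine Comparable.const_mul (C := max C₁ C₂) ⟨?_, ?_⟩ hk0 (hC₁.le.trans (le_max_left _ _))
    (mul_nonneg hw.le hSn) hMn
  · have := mul_le_mul_of_nonneg_left (hU _ _ h1 h2 h3).2 hw.le
    rw [mul_left_comm, hmodel] at this
    exact this.trans (mul_le_mul_of_nonneg_right (le_max_left _ _) hMn)
  · have := mul_le_mul_of_nonneg_left (hL _ _ h1 h2 h3) hw.le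
    rw [hmodel, mul_left_comm (sh * ch ^ (-(α + β + 2))) C₂] at this
    exact this.trans (mul_le_mul_of_nonneg_right (le_max_right _ _) (mul_nonneg hw.le hSn))

/-! ### Elementary estimates for bounded time -/

/-- Below: cosh x - 1 = 2 sinh²(x/2) and sinh y ≥ y for y ≥ 0. Above: cosh x ≤ e^u with u = x²/2,
and e^u - 1 ≤ u e^u. -/
lemma cosh_sub_one_bounds (x : ℝ) :
    x ^ 2 / 2 ≤ Real.cosh x - 1 ∧ Real.cosh x - 1 ≤ x ^ 2 / 2 * Real.exp (x ^ 2 / 2) := by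
  constructor
  · have h : ∀ y : ℝ, 0 ≤ y → y ^ 2 / 2 ≤ Real.cosh y - 1 := by
      intro y hy
      have h1 := Real.cosh_two_mul (y / 2)
      have h2 := Real.cosh_sq (y / 2)
      have h3 : y / 2 ≤ Real.sinh (y / 2) := Real.self_le_sinh_iff.2 (by positivity)
      rw [mul_div_cancel₀ y two_ne_zero] at h1
      have h4 := pow_le_pow_left₀ (by positivity) h3 2
      nlinarith
    have := h |x| (abs_nonneg x)
    rwa [sq_abs, Real.cosh_abs] at this
  · have h1 := Real.cosh_le_exp_half_sq x
    have h2 := Real.add_one_le_exp (-(x ^ 2 / 2))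
    have h3 : Real.exp (-(x ^ 2 / 2)) * Real.exp (x ^ 2 / 2) = 1 := by
      rw [← Real.exp_add]; simp
    have h4 := mul_le_mul_of_nonneg_right h2 (Real.exp_pos (x ^ 2 / 2)).le
    linarith

lemma one_sub_cos_bounds {x : ℝ} (h0 : 0 ≤ x) (h1 : x ≤ Real.pi) :
    2 * (x / Real.pi) ^ 2 ≤ 1 - Real.cos x ∧ 1 - Real.cos x ≤ x ^ 2 / 2 := by
  refine ⟨?_, by linarith [Real.one_sub_sq_div_two_le_cos (x := x)]⟩
  have h2 := one_sub_cos_div_two x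
  have h3 := Real.mul_le_sin (x := x / 2) (by linarith) (by linarith)
  have h4 := pow_le_pow_left₀ (by positivity) h3 2
  have e : 2 / Real.pi * (x / 2) = x / Real.pi := by ring
  rw [e] at h4
  linarith

/-- The difference splits as (cosh(t/2) - 1) + (1 - ab) with cosines a, b in [0,1]. The first part
is of order t² for t ≤ T. The second lies between half of (1-a) + (1-b) and the whole of it, which
is of order θ² + φ². -/
lemma exists_comparable_cosh_sub (T : ℝ) : ∃ C, 0 < C ∧ ∀ t θ φ : ℝ, 0 < t → t ≤ T →
    θ ∈ Set.Icc 0 Real.pi → φ ∈ Set.Icc 0 Real.pi →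
      Comparable C (Real.cosh (t / 2) - Real.cos (θ / 2) * Real.cos (φ / 2))
        (t ^ 2 + θ ^ 2 + φ ^ 2) := by
  have hpi := Real.pi_pos
  refine ⟨Real.exp (T ^ 2 / 8) + 4 * Real.pi ^ 2 + 8, by positivity,
    fun t θ φ ht htT hθ hφ => ?_⟩
  obtain ⟨a1, a2⟩ := cosh_sub_one_bounds (t / 2)
  obtain ⟨b1, b2⟩ := one_sub_cos_bounds (x := θ / 2) (by linarith [hθ.1]) (by linarith [hθ.2])
  obtain ⟨d1, d2⟩ := one_sub_cos_bounds (x := φ / 2) (by linarith [hφ.1]) (by linarith [hφ.2])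
  have c1 : 0 ≤ Real.cos (θ / 2) :=
    Real.cos_nonneg_of_neg_pi_div_two_le_of_le (by linarith [hθ.1]) (by linarith [hθ.2])
  have c2 : 0 ≤ Real.cos (φ / 2) :=
    Real.cos_nonneg_of_neg_pi_div_two_le_of_le (by linarith [hφ.1]) (by linarith [hφ.2])
  have l1 := Real.cos_le_one (θ / 2)
  have l2 := Real.cos_le_one (φ / 2)
  have hup : 1 - Real.cos (θ / 2) * Real.cos (φ / 2) ≤
      (1 - Real.cos (θ / 2)) + (1 - Real.cos (φ / 2)) := by nlinarith
  have hlow : (1 - Real.cos (θ / 2)) + (1 - Real.cos (φ / 2)) ≤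
      2 * (1 - Real.cos (θ / 2) * Real.cos (φ / 2)) := by nlinarith
  set X := Real.cos (θ / 2) * Real.cos (φ / 2)
  have hE : 1 ≤ Real.exp (T ^ 2 / 8) := Real.one_le_exp (by positivity)
  have hexp : Real.exp ((t / 2) ^ 2 / 2) ≤ Real.exp (T ^ 2 / 8) := by
    refine Real.exp_le_exp.2 ?_
    nlinarith
  have hX0 : 0 ≤ Real.cosh (t / 2) - X := by
    have : 0 ≤ (t / 2) ^ 2 / 2 := by positivity
    nlinarith [sq_nonneg (θ / 2 / Real.pi), sq_nonneg (φ / 2 / Real.pi)]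
  constructor
  · have h1 : Real.cosh (t / 2) - 1 ≤ (t / 2) ^ 2 / 2 * Real.exp (T ^ 2 / 8) :=
      a2.trans (mul_le_mul_of_nonneg_left hexp (by positivity))
    have h2 : (θ / 2) ^ 2 / 2 + (φ / 2) ^ 2 / 2 ≤
        ((θ / 2) ^ 2 / 2 + (φ / 2) ^ 2 / 2) * Real.exp (T ^ 2 / 8) :=
      le_mul_of_one_le_right (by positivity) hE
    have h3 : Real.cosh (t / 2) - X ≤ Real.exp (T ^ 2 / 8) * (t ^ 2 + θ ^ 2 + φ ^ 2) := by
      have : 0 ≤ Real.exp (T ^ 2 / 8) * (t ^ 2 + θ ^ 2 + φ ^ 2) := by positivity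
      linarith
    refine h3.trans (mul_le_mul_of_nonneg_right ?_ (by positivity))
    nlinarith
  · have h1 : t ^ 2 ≤ 8 * (Real.cosh (t / 2) - 1) := by linarith
    have h2 : θ ^ 2 + φ ^ 2 ≤ 4 * Real.pi ^ 2 * (1 - X) := by
      have e : θ ^ 2 + φ ^ 2 = 2 * Real.pi ^ 2 *
          (2 * (θ / 2 / Real.pi) ^ 2 + 2 * (φ / 2 / Real.pi) ^ 2) := by field_simp
      rw [e]
      have : 2 * (θ / 2 / Real.pi) ^ 2 + 2 * (φ / 2 / Real.pi) ^ 2 ≤ 2 * (1 - X) := by linarith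
      calc _ ≤ 2 * Real.pi ^ 2 * (2 * (1 - X)) :=
            mul_le_mul_of_nonneg_left this (by positivity)
        _ = _ := by ring
    have h3 : 0 ≤ Real.cosh (t / 2) - 1 := by linarith [Real.one_le_cosh (t / 2)]
    have h4 : 0 ≤ 1 - X := by
      have : 0 ≤ 4 * Real.pi ^ 2 * (1 - X) := le_trans (by positivity) h2
      exact nonneg_of_mul_nonneg_right this (by positivity)
    have p1 : 0 ≤ 4 * Real.pi ^ 2 * (Real.cosh (t / 2) - 1) := by positivity
    have p2 : 0 ≤ Real.exp (T ^ 2 / 8) * (Real.cosh (t / 2) - X) := by positivity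
    linarith

lemma comparable_sinh {t T : ℝ} (ht : 0 < t) (htT : t ≤ T) :
    Comparable (Real.exp (T / 2) + 2) (Real.sinh (t / 2)) t := by
  have h1 : t / 2 ≤ Real.sinh (t / 2) := Real.self_le_sinh_iff.2 (by positivity)
  have hE : Real.exp (t / 2) ≤ Real.exp (T / 2) := Real.exp_le_exp.2 (by linarith)
  have hE0 := Real.exp_pos (t / 2)
  constructor
  · have h2 := Real.add_one_le_exp (-t)
    have h3 : Real.exp (-t) * Real.exp (t / 2) = Real.exp (-(t / 2)) := by
      rw [← Real.exp_add]; congr 1; ring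
    have h4 := mul_le_mul_of_nonneg_right h2 hE0.le
    rw [h3] at h4
    have h5 : Real.sinh (t / 2) ≤ t / 2 * Real.exp (t / 2) := by rw [Real.sinh_eq]; linarith
    nlinarith
  · nlinarith [Real.exp_pos (T / 2)]

lemma exists_comparable_small {α β : ℝ} (hα : -(1 / 2) ≤ α) (hβ : -(1 / 2) ≤ β) (T : ℝ) :
    ∃ C, 0 < C ∧ ∀ t θ φ : ℝ, 0 < t → t ≤ T → θ ∈ Set.Icc 0 Real.pi → φ ∈ Set.Icc 0 Real.pi →
      Comparable C (kernelModel α β t θ φ)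
        ((t ^ 2 + θ ^ 2 + φ ^ 2) ^ (-α - 1 / 2) *
          (t ^ 2 + (Real.pi - θ) ^ 2 + (Real.pi - φ) ^ 2) ^ (-β - 1 / 2) *
          (t / (t ^ 2 + (θ - φ) ^ 2))) := by
  obtain ⟨C, hC, h⟩ := exists_comparable_cosh_sub T
  have hS : 0 < Real.exp (T / 2) + 2 := by positivity
  refine ⟨C ^ (α + 1 / 2) * C ^ (β + 1 / 2) * ((Real.exp (T / 2) + 2) * C), by positivity,
    fun t θ φ ht htT hθ hφ => ?_⟩
  have hch : 1 < Real.cosh (t / 2) := Real.one_lt_cosh.2 (by positivity)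
  have hθ' : Real.pi - θ ∈ Set.Icc 0 Real.pi := ⟨by linarith [hθ.2], by linarith [hθ.1]⟩
  have hφ' : Real.pi - φ ∈ Set.Icc 0 Real.pi := ⟨by linarith [hφ.2], by linarith [hφ.1]⟩
  have hd : |θ - φ| ∈ Set.Icc 0 Real.pi :=
    ⟨abs_nonneg _, abs_le.2 ⟨by linarith [hθ.1, hφ.2], by linarith [hθ.2, hφ.1]⟩⟩
  -- One comparison serves all three factors: at (θ, φ), at the reflected pair (π-θ, π-φ), which
  -- turns cosines into sines, and at (|θ-φ|, 0).
  have k1 := h t θ φ ht htT hθ hφ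
  have k2 := h t _ _ ht htT hθ' hφ'
  have k3 := h t _ 0 ht htT hd ⟨le_rfl, Real.pi_pos.le⟩
  have es : ∀ x : ℝ, Real.cos ((Real.pi - x) / 2) = Real.sin (x / 2) := fun x => by
    rw [sub_div, Real.cos_pi_div_two_sub]
  have ea : Real.cos (|θ - φ| / 2) = Real.cos ((θ - φ) / 2) := by
    rw [← abs_of_pos (zero_lt_two (α := ℝ)), ← abs_div, Real.cos_abs, abs_of_pos zero_lt_two]
  rw [es, es] at k2
  rw [zero_div, Real.cos_zero, mul_one, ea, sq_abs, zero_pow two_ne_zero, add_zero] at k3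
  have d1 : 0 < Real.cosh (t / 2) - Real.cos (θ / 2) * Real.cos (φ / 2) := by
    have h1 := Real.abs_cos_le_one (θ / 2)
    have h2 := Real.abs_cos_le_one (φ / 2)
    have h3 : |Real.cos (θ / 2) * Real.cos (φ / 2)| ≤ 1 := by
      rw [abs_mul]; exact mul_le_one₀ h1 (abs_nonneg _) h2
    linarith [le_abs_self (Real.cos (θ / 2) * Real.cos (φ / 2))]
  have d2 : 0 < Real.cosh (t / 2) - Real.sin (θ / 2) * Real.sin (φ / 2) := by
    have h1 := Real.abs_sin_le_one (θ / 2)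
    have h2 := Real.abs_sin_le_one (φ / 2)
    have h3 : |Real.sin (θ / 2) * Real.sin (φ / 2)| ≤ 1 := by
      rw [abs_mul]; exact mul_le_one₀ h1 (abs_nonneg _) h2
    linarith [le_abs_self (Real.sin (θ / 2) * Real.sin (φ / 2))]
  have d3 : 0 < Real.cosh (t / 2) - Real.cos ((θ - φ) / 2) := by
    linarith [Real.cos_le_one ((θ - φ) / 2)]
  have u1 : 0 < t ^ 2 + θ ^ 2 + φ ^ 2 := by positivity
  have u2 : 0 < t ^ 2 + (Real.pi - θ) ^ 2 + (Real.pi - φ) ^ 2 := by positivity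
  have u3 : 0 < t ^ 2 + (θ - φ) ^ 2 := by positivity
  have hsh : 0 < Real.sinh (t / 2) := Real.sinh_pos_iff.2 (by positivity)
  have m1 := k1.rpow_neg d1 u1 hC (a := α + 1 / 2) (by linarith)
  have m2 := k2.rpow_neg d2 u2 hC (a := β + 1 / 2) (by linarith)
  have m3 := (comparable_sinh ht htT).mul (k3.inv d3 u3 hC) hsh.le ht.le (inv_pos.2 d3).le
    (inv_pos.2 u3).le hS.le
  rw [show -α - 1 / 2 = -(α + 1 / 2) by ring, show -β - 1 / 2 = -(β + 1 / 2) by ring,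
    div_eq_mul_inv]
  exact (m1.mul m2 (by positivity) (by positivity) (by positivity) (by positivity)
    (by positivity)).mul m3 (by positivity) (by positivity) (by positivity) (by positivity)
    (by positivity)

/-! ### Elementary estimates for large time -/

lemma comparable_cosh_exp {t : ℝ} (ht : 0 ≤ t) :
    Comparable 2 (Real.cosh (t / 2)) (Real.exp (t / 2)) := by
  have h1 : Real.exp (-(t / 2)) ≤ Real.exp (t / 2) := Real.exp_le_exp.2 (by linarith)
  have h2 := Real.exp_pos (-(t / 2))
  have h3 := Real.exp_pos (t / 2)
  rw [Real.cosh_eq]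
  constructor <;> linarith

/-- For t ≥ T, cosh(t/2) - 1 is at least a fixed fraction κ of cosh(t/2). Hence cosh(t/2) - y is
comparable to e^(t/2) uniformly for y in [0,1], and so is sinh(t/2). The last quotient of the model
is then of order 1, and the two powers give the exponential. -/
lemma exists_comparable_large {α β : ℝ} (hα : -(1 / 2) ≤ α) (hβ : -(1 / 2) ≤ β) {T : ℝ}
    (hT : 0 < T) : ∃ C, 0 < C ∧ ∀ t θ φ : ℝ, T ≤ t → θ ∈ Set.Icc 0 Real.pi →
      φ ∈ Set.Icc 0 Real.pi →
        Comparable C (kernelModel α β t θ φ) (Real.exp (-t * ((α + β + 1) / 2))) := by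
  have hchT : 1 < Real.cosh (T / 2) := Real.one_lt_cosh.2 (by positivity)
  set κ := 1 - (Real.cosh (T / 2))⁻¹ with hκ
  have hκ0 : 0 < κ := sub_pos.2 (inv_lt_one_of_one_lt₀ hchT)
  set D := 2 * (κ⁻¹ + 1) with hD
  have hD0 : 0 < D := by positivity
  have hE : 0 < 1 - Real.exp (-T) := by linarith [exp_neg_lt_one hT]
  set D' := 2 * (1 - Real.exp (-T))⁻¹ + 1 with hD'
  have hD'0 : 0 < D' := by positivity
  refine ⟨D ^ (α + 1 / 2) * D ^ (β + 1 / 2) * (D' * D), by positivity,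
    fun t θ φ htT hθ hφ => ?_⟩
  have ht : 0 < t := hT.trans_le htT
  have hmono : Real.cosh (T / 2) ≤ Real.cosh (t / 2) := by
    rw [Real.cosh_le_cosh, abs_of_pos (by positivity), abs_of_pos (by positivity)]
    linarith
  have hch0 : 0 < Real.cosh (t / 2) := by linarith
  have he := Real.exp_pos (t / 2)
  have hκch : κ * Real.cosh (t / 2) ≤ Real.cosh (t / 2) - 1 := by
    have : 1 ≤ (Real.cosh (T / 2))⁻¹ * Real.cosh (t / 2) := by
      rw [inv_mul_eq_div, one_le_div (by linarith)]; exact hmono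
    rw [hκ, sub_mul]
    linarith
  have key : ∀ y : ℝ, 0 ≤ y → y ≤ 1 → 0 < Real.cosh (t / 2) - y ∧
      Comparable D (Real.cosh (t / 2) - y) (Real.exp (t / 2)) := by
    intro y h0 h1
    have hp : 0 < Real.cosh (t / 2) - y := by
      have := mul_pos hκ0 hch0
      linarith
    refine ⟨hp, ?_⟩
    have hc : Comparable (κ⁻¹ + 1) (Real.cosh (t / 2) - y) (Real.cosh (t / 2)) := by
      constructor
      · have := mul_pos (inv_pos.2 hκ0) hch0
        linarith
      · have h2 : Real.cosh (t / 2) ≤ κ⁻¹ * (Real.cosh (t / 2) - y) := by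
          rw [inv_mul_eq_div, le_div_iff₀ hκ0]
          linarith
        linarith
    have := hc.trans (comparable_cosh_exp ht.le) (by positivity) zero_le_two
    rwa [mul_comm] at this
  have s1 : 0 ≤ Real.sin (θ / 2) :=
    Real.sin_nonneg_of_nonneg_of_le_pi (by linarith [hθ.1]) (by linarith [hθ.2, Real.pi_pos])
  have s2 : 0 ≤ Real.sin (φ / 2) :=
    Real.sin_nonneg_of_nonneg_of_le_pi (by linarith [hφ.1]) (by linarith [hφ.2, Real.pi_pos])
  have c1 : 0 ≤ Real.cos (θ / 2) :=
    Real.cos_nonneg_of_neg_pi_div_two_le_of_le (by linarith [hθ.1, Real.pi_pos])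
      (by linarith [hθ.2])
  have c2 : 0 ≤ Real.cos (φ / 2) :=
    Real.cos_nonneg_of_neg_pi_div_two_le_of_le (by linarith [hφ.1, Real.pi_pos])
      (by linarith [hφ.2])
  have c3 : 0 ≤ Real.cos ((θ - φ) / 2) :=
    Real.cos_nonneg_of_neg_pi_div_two_le_of_le (by linarith [hθ.1, hφ.2])
      (by linarith [hθ.2, hφ.1])
  obtain ⟨d1, k1⟩ := key _ (mul_nonneg c1 c2)
    (mul_le_one₀ (Real.cos_le_one _) c2 (Real.cos_le_one _))
  obtain ⟨d2, k2⟩ := key _ (mul_nonneg s1 s2)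
    (mul_le_one₀ (Real.sin_le_one _) s2 (Real.sin_le_one _))
  obtain ⟨d3, k3⟩ := key _ c3 (Real.cos_le_one _)
  have hsh : 0 < Real.sinh (t / 2) := Real.sinh_pos_iff.2 (by positivity)
  have ksh : Comparable D' (Real.sinh (t / 2)) (Real.exp (t / 2)) := by
    have h1 := (exp_neg_eq_cosh t).2
    have h2 : Real.exp (-t) ≤ Real.exp (-T) := Real.exp_le_exp.2 (by linarith)
    have h3 : Real.exp (-(t / 2)) * Real.exp (t / 2) = 1 := by rw [← Real.exp_add]; simp
    have h4 : Real.exp (t / 2) * (1 - Real.exp (-t)) = 2 * Real.sinh (t / 2) := by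
      rw [h1]; linear_combination (2 * Real.sinh (t / 2)) * h3
    have h5 := inv_pos.2 hE
    constructor
    · have h6 : Real.sinh (t / 2) ≤ Real.exp (t / 2) := by
        rw [Real.sinh_eq]
        linarith [Real.exp_pos (-(t / 2))]
      have := mul_pos h5 he
      linarith
    · have h7 : Real.exp (t / 2) * (1 - Real.exp (-T)) ≤ 2 * Real.sinh (t / 2) := by
        rw [← h4]; exact mul_le_mul_of_nonneg_left (by linarith) he.le
      have h8 : Real.exp (t / 2) ≤ (1 - Real.exp (-T))⁻¹ * (2 * Real.sinh (t / 2)) := by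
        rw [inv_mul_eq_div, le_div_iff₀ hE]; exact h7
      linarith
  have m1 := k1.rpow_neg d1 he hD0 (a := α + 1 / 2) (by linarith)
  have m2 := k2.rpow_neg d2 he hD0 (a := β + 1 / 2) (by linarith)
  have m3 := ksh.mul (k3.inv d3 he hD0) hsh.le he.le (inv_pos.2 d3).le (inv_pos.2 he).le hD'0.le
  have e : Real.exp (-t * ((α + β + 1) / 2)) = Real.exp (t / 2) ^ (-(α + 1 / 2)) *
      Real.exp (t / 2) ^ (-(β + 1 / 2)) * (Real.exp (t / 2) * (Real.exp (t / 2))⁻¹) := by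
    rw [mul_inv_cancel₀ he.ne', mul_one, ← Real.exp_mul, ← Real.exp_mul, ← Real.exp_add]
    congr 1
    ring
  rw [e]
  exact (m1.mul m2 (by positivity) (by positivity) (by positivity) (by positivity)
    (by positivity)).mul m3 (by positivity) (by positivity) (by positivity) (by positivity)
    (by positivity)

end

end JacobiPoisson

end

theorem mainTheorem3 (α β : ℝ) (hα : -(1 / 2) ≤ α) (hβ : -(1 / 2) ≤ β) (T : ℝ) (hT : 0 < T) :
    (∀ t θ φ : ℝ, 0 < t → θ ∈ Set.Icc 0 Real.pi → φ ∈ Set.Icc 0 Real.pi →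
      Summable (fun n : ℕ => Real.exp (-t * |(n : ℝ) + (α + β + 1) / 2|) *
        JacobiPoisson.trigJacobi α β n θ * JacobiPoisson.trigJacobi α β n φ)) ∧
    (∃ C : ℝ, 0 < C ∧ ∀ t θ φ : ℝ, 0 < t → t ≤ T →
      θ ∈ Set.Icc 0 Real.pi → φ ∈ Set.Icc 0 Real.pi →
        JacobiPoisson.poissonKernel α β t θ φ ≤
          C * ((t ^ 2 + θ ^ 2 + φ ^ 2) ^ (-α - 1 / 2) *
            (t ^ 2 + (Real.pi - θ) ^ 2 + (Real.pi - φ) ^ 2) ^ (-β - 1 / 2) *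
            (t / (t ^ 2 + (θ - φ) ^ 2))) ∧
        (t ^ 2 + θ ^ 2 + φ ^ 2) ^ (-α - 1 / 2) *
            (t ^ 2 + (Real.pi - θ) ^ 2 + (Real.pi - φ) ^ 2) ^ (-β - 1 / 2) *
            (t / (t ^ 2 + (θ - φ) ^ 2)) ≤
          C * JacobiPoisson.poissonKernel α β t θ φ) ∧
    (∃ C : ℝ, 0 < C ∧ ∀ t θ φ : ℝ, T ≤ t →
      θ ∈ Set.Icc 0 Real.pi → φ ∈ Set.Icc 0 Real.pi →
        JacobiPoisson.poissonKernel α β t θ φ ≤ C * Real.exp (-t * ((α + β + 1) / 2)) ∧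
        Real.exp (-t * ((α + β + 1) / 2)) ≤ C * JacobiPoisson.poissonKernel α β t θ φ) := by
  obtain ⟨C₀, hC₀, h₀⟩ := JacobiPoisson.exists_comparable_kernelModel hα hβ
  obtain ⟨C₁, hC₁, h₁⟩ := JacobiPoisson.exists_comparable_small hα hβ T
  obtain ⟨C₂, hC₂, h₂⟩ := JacobiPoisson.exists_comparable_large hα hβ hT
  refine ⟨fun t θ φ ht _ _ => JacobiPoisson.summable_poissonKernel hα hβ ht θ φ,
    ⟨C₀ * C₁, by positivity, fun t θ φ ht htT hθ hφ => ?_⟩,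
    ⟨C₀ * C₂, by positivity, fun t θ φ htT hθ hφ => ?_⟩⟩
  · exact (h₀ t θ φ ht hθ hφ).trans (h₁ t θ φ ht htT hθ hφ) hC₀.le hC₁.le
  · exact (h₀ t θ φ (hT.trans_le htT) hθ hφ).trans (h₂ t θ φ htT hθ hφ) hC₀.le hC₂.le
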